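/- Let $\mathbb T=\mathbb R/2\pi\mathbb Z$, let $c>0$, and set $$Q_c(x)=\sqrt{\tfrac c2}\,\tanh\Big(\sqrt{\tfrac c2}\,x\Big),\qquad \varphi_c(x)=c\,\cosh^{-2}\Big(\sqrt{\tfrac c2}\,x\Big).$$ All functions are real-valued, or all are complex-valued (the statement holds in both cases). For $u\in L^2(\mathbb R_x\times\mathbb T_y)$ let $\hat u(\xi,n)$, $(\xi,n)\in\mathbb R\times\mathbb Z$, be its unitary Fourier transform. The operators $\partial_x$ and $\partial_x^{-1}\partial_y$ are the Fourier multipliers with symbols $i\xi$ and $(i\xi)^{-1}(in)=n/\xi$. Let $\mathcal E$ be the space of all $u\in L^2(\mathbb R\times\mathbb T)$ with $$\|u\|_{\mathcal E}^2=\sum_{n\in\mathbb Z}\int_{\mathbb R}(1+\xi^2+\xi^{-2}n^2)\,|\hat u(\xi,n)|^2\,d\xi=\|u\|_{L^2}^2+\|\partial_xu\|_{L^2}^2+\|\partial_x^{-1}\partial_yu\|_{L^2}^2<\infty .$$ Consider $$L_c=\partial_x+\partial_x^{-1}\partial_y-2Q_c(x),\qquad \mathcal L_c=-\partial_x+\partial_x^{-1}\partial_y-2Q_c(x)$$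 as bounded operators from $\mathcal E$ to $L^2(\mathbb R\times\mathbb T)$; $\mathcal L_c$ is the formal adjoint of $L_c$, that is, $(L_cw,v)_{L^2}=(w,\mathcal L_cv)_{L^2}$ for all $w,v\in\mathcal E$. Then: 1. $\ker(L_c)=\{0\}$ and $\ker(\mathcal L_c)=\operatorname{span}\{\varphi_c\}$. 2. $L_c$ is a Fredholm operator and $\operatorname{Range}(L_c)=(\varphi_c)^\perp=\{u\in L^2(\mathbb R\times\mathbb T):(u,\varphi_c)_{L^2}=0\}$. 3. There is a constant $C>0$, independent of $w$, such that $\|w\|_{\mathcal E}\le C\,\|L_cw\|_{L^2}$ for all $w\in\mathcal E$. -/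

import Mathlib

open MeasureTheory
open scoped Real ENNReal FourierTransform

noncomputable section

namespace KPII

/-! ### The space `L²(ℝ × 𝕋)`, with `𝕋 = ℝ / 2πℤ` and Lebesgue measure -/

instance factTwoPiPos : Fact ((0 : ℝ) < 2 * π) := ⟨Real.two_pi_pos⟩

/-- The torus `𝕋 = ℝ / 2πℤ`; its `volume` is Lebesgue measure, of total mass `2π`. -/
abbrev Torus : Type := AddCircle (2 * π)

/-- `L²(ℝ × 𝕋)`, of real-valued (`𝕜 = ℝ`) or complex-valued (`𝕜 = ℂ`) functions. -/
abbrev L2 (𝕜 : Type*) [RCLike 𝕜] : Type _ := Lp 𝕜 2 (volume : Measure (ℝ × Torus))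

section Fourier

variable {𝕜 : Type*} [RCLike 𝕜]

/-! ### The Fourier transform on `ℝ × 𝕋`

`RCLike.map 𝕜 ℂ` is the inclusion of `𝕜` in `ℂ`. -/

/-- The unitary Fourier coefficient `(2π)^{-1/2} ∫_𝕋 e^{-iny} f(y) dy`. -/
def coefficient (f : Torus → 𝕜) (n : ℤ) : ℂ :=
  (Real.sqrt (2 * π))⁻¹ • ∫ y : Torus, fourier (-n) y • RCLike.map 𝕜 ℂ (f y)

/-- The `n`-th Fourier mode in `y`: `u_n(x) = (2π)^{-1/2} ∫_𝕋 e^{-iny} u(x, y) dy`. -/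
def yMode (u : ℝ × Torus → 𝕜) (n : ℤ) (x : ℝ) : ℂ := coefficient (fun y => u (x, y)) n

lemma norm_rclike_map (z : 𝕜) : ‖RCLike.map 𝕜 ℂ z‖ = ‖z‖ := by
  have h := RCLike.norm_sq_eq_def (K := ℂ) (z := RCLike.map 𝕜 ℂ z)
  have h2 := RCLike.norm_sq_eq_def (K := 𝕜) (z := z)
  simp only [RCLike.map_apply] at h
  rw [← sq_eq_sq₀ (norm_nonneg _) (norm_nonneg _), h2]
  simpa using h

lemma rclike_map_mul (a b : 𝕜) :
    RCLike.map 𝕜 ℂ (a * b) = RCLike.map 𝕜 ℂ a * RCLike.map 𝕜 ℂ b := by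
  apply Complex.ext <;> simp

lemma memLp_rclike_map {α : Type*} [MeasurableSpace α] {μ : Measure α} {f : α → 𝕜} {p : ℝ≥0∞}
    (hf : MemLp f p μ) : MemLp (fun y => RCLike.map 𝕜 ℂ (f y)) p μ :=
  (RCLike.map 𝕜 ℂ).comp_memLp' hf

lemma hasSum_sq_coefficient_aux {T : ℝ} [hT : Fact (0 < T)] {f : AddCircle T → ℂ}
    (hf : MemLp f 2 volume) :
    HasSum (fun n : ℤ => ‖(Real.sqrt T)⁻¹ • ∫ y : AddCircle T, fourier (-n) y • f y‖ ^ 2)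
      (∫ y, ‖f y‖ ^ 2) := by
  have hg' := hf.haarAddCircle
  have hT0 := hT.out
  have h := (hasSum_sq_fourierCoeff (hg'.toLp f)).mul_left T
  have e1 : ∫ t, ‖(hg'.toLp f : AddCircle T → ℂ) t‖ ^ 2 ∂AddCircle.haarAddCircle
      = ∫ t, ‖f t‖ ^ 2 ∂AddCircle.haarAddCircle := by
    apply integral_congr_ae
    filter_upwards [hg'.coeFn_toLp] with x hx
    rw [hx]
  rw [e1, AddCircle.integral_haarAddCircle, smul_eq_mul, mul_inv_cancel_left₀ hT0.ne'] at h
  have e2 : (fun n : ℤ => ‖(Real.sqrt T)⁻¹ • ∫ y : AddCircle T, fourier (-n) y • f y‖ ^ 2) =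
      fun n : ℤ => T * ‖fourierCoeff (hg'.toLp f) n‖ ^ 2 := by
    ext n
    rw [fourierCoeff_congr_ae hg'.coeFn_toLp, fourierCoeff, AddCircle.integral_haarAddCircle,
      norm_smul, norm_smul, mul_pow, mul_pow]
    simp only [norm_inv, inv_pow, Real.norm_eq_abs, sq_abs, Real.sq_sqrt hT0.le]
    field_simp
  rw [e2]
  exact h

/-- Parseval's identity on the torus. -/
lemma hasSum_sq_coefficient {f : Torus → 𝕜} (hf : MemLp f 2 volume) :
    HasSum (fun n => ‖coefficient f n‖ ^ 2) (∫ y, ‖f y‖ ^ 2) := by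
  have := hasSum_sq_coefficient_aux (memLp_rclike_map hf)
  simp only [norm_rclike_map] at this
  exact this

lemma memLp_fibre (u : L2 𝕜) : ∀ᵐ x : ℝ, MemLp (fun y : Torus => u (x, y)) 2 volume := by
  have h1 := (memLp_two_iff_integrable_sq_norm (Lp.aestronglyMeasurable u)).1 (Lp.memLp u)
  filter_upwards [h1.prod_right_ae, (Lp.aestronglyMeasurable u).prodMk_left] with x hx hm
  exact (memLp_two_iff_integrable_sq_norm hm).2 hx

lemma aestronglyMeasurable_yMode (u : L2 𝕜) (n : ℤ) :
    AEStronglyMeasurable (yMode u n) volume := by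
  have h : AEStronglyMeasurable
      (fun p : ℝ × Torus => fourier (-n) p.2 • RCLike.map 𝕜 ℂ (u p)) volume := by
    have h1 : AEStronglyMeasurable (fun p : ℝ × Torus => (fourier (-n) p.2 : ℂ)) volume :=
      ((fourier (-n)).continuous.comp continuous_snd).aestronglyMeasurable
    exact h1.smul
      ((RCLike.map 𝕜 ℂ).continuous.comp_aestronglyMeasurable (Lp.aestronglyMeasurable u))
  exact (AEStronglyMeasurable.integral_prod_right' h).const_smul (Real.sqrt (2 * π))⁻¹

lemma memLp_yMode (u : L2 𝕜) (n : ℤ) : MemLp (yMode u n) 2 volume := by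
  rw [memLp_two_iff_integrable_sq_norm (aestronglyMeasurable_yMode u n)]
  have hi : Integrable (fun x : ℝ => ∫ y : Torus, ‖u (x, y)‖ ^ 2) :=
    ((memLp_two_iff_integrable_sq_norm (Lp.aestronglyMeasurable u)).1
      (Lp.memLp u)).integral_prod_left
  refine hi.mono' ((aestronglyMeasurable_yMode u n).norm.pow 2) ?_
  filter_upwards [memLp_fibre u] with x hx
  rw [Real.norm_of_nonneg (by positivity)]
  exact le_hasSum (hasSum_sq_coefficient hx) n (fun _ _ => by positivity)

/-- The Fourier transform of `u ∈ L²(ℝ × 𝕋)`: for every `n ∈ ℤ`, the `L²(ℝ)`-Fourier transform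
(Plancherel extension) of the mode `u_n`. Mathlib's transform on `ℝ` has the kernel `e^{-2πixη}`, so
the frequency dual to `x` with respect to `e^{-ixξ}` is `ξ = 2πη`, and `hat u n η` is
`(2π)^{1/2} û(ξ, n)` for the unitary transform `û`. -/
def hat (u : L2 𝕜) (n : ℤ) : Lp ℂ 2 (volume : Measure ℝ) := 𝓕 (memLp_yMode u n).toLp

lemma integrable_kernel {f : Torus → 𝕜} (hf : MemLp f 2 volume) (n : ℤ) :
    Integrable (fun y : Torus => fourier (-n) y • RCLike.map 𝕜 ℂ (f y)) := by
  refine Integrable.mono ((memLp_rclike_map hf).integrable one_le_two)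
    ((fourier (-n)).continuous.aestronglyMeasurable.smul (memLp_rclike_map hf).1) ?_
  filter_upwards with y
  rw [norm_smul, fourier_apply, Circle.norm_coe, one_mul]

lemma coefficient_add {f g : Torus → 𝕜} (hf : MemLp f 2 volume) (hg : MemLp g 2 volume) (n : ℤ) :
    coefficient (fun y => f y + g y) n = coefficient f n + coefficient g n := by
  simp only [coefficient, map_add, smul_add]
  rw [integral_add (integrable_kernel hf n) (integrable_kernel hg n), smul_add]

lemma coefficient_smul (a : 𝕜) (f : Torus → 𝕜) (n : ℤ) :
    coefficient (fun y => a * f y) n = RCLike.map 𝕜 ℂ a * coefficient f n := by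
  simp only [coefficient, rclike_map_mul, smul_eq_mul]
  rw [mul_smul_comm, ← integral_const_mul]
  congr 2
  ext y
  ring

lemma coefficient_congr {f g : Torus → 𝕜} (h : f =ᵐ[volume] g) (n : ℤ) :
    coefficient f n = coefficient g n := by
  unfold coefficient
  congr 1
  apply integral_congr_ae
  filter_upwards [h] with y hy
  rw [hy]

lemma hat_add (u v : L2 𝕜) (n : ℤ) : hat (u + v) n = hat u n + hat v n := by
  unfold hat
  rw [← FourierTransform.fourier_add, ← MemLp.toLp_add]
  congr 1
  rw [MemLp.toLp_eq_toLp_iff]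
  have h : ∀ᵐ x : ℝ, ∀ᵐ y : Torus, (u + v : L2 𝕜) (x, y) = u (x, y) + v (x, y) :=
    Measure.ae_ae_of_ae_prod (Lp.coeFn_add u v)
  filter_upwards [h, memLp_fibre u, memLp_fibre v] with x hx hu hv
  simp only [yMode, Pi.add_apply]
  rw [coefficient_congr hx, coefficient_add hu hv]

lemma hat_smul (a : 𝕜) (u : L2 𝕜) (n : ℤ) : hat (a • u) n = RCLike.map 𝕜 ℂ a • hat u n := by
  unfold hat
  rw [← FourierTransform.fourier_smul, ← MemLp.toLp_const_smul]
  congr 1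
  rw [MemLp.toLp_eq_toLp_iff]
  have h : ∀ᵐ x : ℝ, ∀ᵐ y : Torus, (a • u : L2 𝕜) (x, y) = a * u (x, y) :=
    Measure.ae_ae_of_ae_prod (Lp.coeFn_smul a u)
  filter_upwards [h] with x hx
  simp only [yMode, Pi.smul_apply, smul_eq_mul]
  rw [coefficient_congr hx, coefficient_smul]

lemma enorm_sq_eq_lintegral {α : Type*} [MeasurableSpace α] {F : Type*} [NormedAddCommGroup F]
    {μ : Measure α} (g : Lp F 2 μ) : ‖g‖ₑ ^ 2 = ∫⁻ x, ‖g x‖ₑ ^ 2 ∂μ := by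
  rw [Lp.enorm_def, eLpNorm_eq_lintegral_rpow_enorm_toReal (by simp) (by simp)]
  simp only [ENNReal.toReal_ofNat, one_div, ENNReal.rpow_ofNat]
  rw [← ENNReal.rpow_natCast, ← ENNReal.rpow_mul]
  simp

/-- Plancherel's identity on `ℝ × 𝕋`. -/
lemma plancherel (u : L2 𝕜) : ∑' n : ℤ, ∫⁻ η : ℝ, ‖hat u n η‖ₑ ^ 2 = ‖u‖ₑ ^ 2 := by
  have h1 (n : ℤ) : ∫⁻ η : ℝ, ‖hat u n η‖ₑ ^ 2 = ∫⁻ x : ℝ, ‖yMode u n x‖ₑ ^ 2 := by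
    rw [← enorm_sq_eq_lintegral, hat]
    have : ‖𝓕 (memLp_yMode u n).toLp‖ₑ = ‖(memLp_yMode u n).toLp‖ₑ := by
      simp only [enorm_eq_iff_norm_eq, Lp.norm_fourier_eq]
    rw [this, enorm_sq_eq_lintegral]
    apply lintegral_congr_ae
    filter_upwards [(memLp_yMode u n).coeFn_toLp] with x hx
    rw [hx]
  simp_rw [h1]
  rw [← lintegral_tsum (fun n => (aestronglyMeasurable_yMode u n).enorm.pow_const 2),
    enorm_sq_eq_lintegral]
  change _ = ∫⁻ p, ‖u p‖ₑ ^ 2 ∂((volume : Measure ℝ).prod (volume : Measure Torus))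
  rw [lintegral_prod _ ((Lp.aestronglyMeasurable u).enorm.pow_const 2)]
  apply lintegral_congr_ae
  filter_upwards [memLp_fibre u] with x hx
  have hs := hasSum_sq_coefficient hx
  have h2 := (memLp_two_iff_integrable_sq_norm hx.1).1 hx
  have e (r : ℂ) : ‖r‖ₑ ^ 2 = ENNReal.ofReal (‖r‖ ^ 2) := by
    rw [← ofReal_norm, ENNReal.ofReal_pow (norm_nonneg _)]
  have e' (r : 𝕜) : ‖r‖ₑ ^ 2 = ENNReal.ofReal (‖r‖ ^ 2) := by
    rw [← ofReal_norm, ENNReal.ofReal_pow (norm_nonneg _)]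
  simp_rw [e, e']
  rw [← ofReal_integral_eq_lintegral_ofReal h2 (by filter_upwards with y; positivity),
    ← hs.tsum_eq, ENNReal.ofReal_tsum_of_nonneg (fun n => by positivity) hs.summable]
  rfl

/-! ### The operators `∂_x` and `∂_x^{-1} ∂_y` and the space `𝓔(ℝ × 𝕋)` -/

/-- `v = ∂_x u` for `u, v ∈ L²(ℝ × 𝕋)`: the Fourier multiplier `iξ`, where `ξ = 2πη`. -/
def IsDx (u v : L2 𝕜) : Prop :=
  ∀ n : ℤ, ∀ᵐ η : ℝ, hat v n η = (Complex.I * (2 * π * η)) * hat u n η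

/-- `w = ∂_x^{-1} ∂_y u` for `u, w ∈ L²(ℝ × 𝕋)`: the Fourier multiplier `(iξ)⁻¹ (in)`, where
`ξ = 2πη`. -/
def IsDxInvDy (u w : L2 𝕜) : Prop :=
  ∀ n : ℤ, ∀ᵐ η : ℝ,
    hat w n η = (Complex.I * (2 * π * η))⁻¹ * ((Complex.I * n) * hat u n η)

lemma hat_zero_ae (n : ℤ) : ∀ᵐ η : ℝ, hat (0 : L2 𝕜) n η = 0 := by
  have h : hat (0 : L2 𝕜) n = 0 := by simpa using hat_smul (0 : 𝕜) (0 : L2 𝕜) n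
  rw [h]
  exact Lp.coeFn_zero ℂ 2 volume

lemma hat_add_ae (u v : L2 𝕜) (n : ℤ) :
    ∀ᵐ η : ℝ, hat (u + v) n η = hat u n η + hat v n η := by
  rw [hat_add]
  exact Lp.coeFn_add _ _

lemma hat_smul_ae (a : 𝕜) (u : L2 𝕜) (n : ℤ) :
    ∀ᵐ η : ℝ, hat (a • u) n η = RCLike.map 𝕜 ℂ a * hat u n η := by
  rw [hat_smul]
  exact Lp.coeFn_smul _ _

variable (𝕜) in
/-- The space `𝓔(ℝ × 𝕋)` of all `u ∈ L²(ℝ × 𝕋)` for which `∂_x u` and `∂_x^{-1} ∂_y u` are in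
`L²(ℝ × 𝕋)`. An element is recorded as the triple `(u, ∂_x u, ∂_x^{-1} ∂_y u)` (the last two
components are determined by `u`), and the norm is
`‖u‖_𝓔² = ‖u‖² + ‖∂_x u‖² + ‖∂_x^{-1} ∂_y u‖²`. -/
def energySpace : Submodule 𝕜 (PiLp 2 (fun _ : Fin 3 => L2 𝕜)) where
  carrier := {p | IsDx (p 0) (p 1) ∧ IsDxInvDy (p 0) (p 2)}
  zero_mem' := by
    refine ⟨fun n => ?_, fun n => ?_⟩ <;>
    · filter_upwards [hat_zero_ae (𝕜 := 𝕜) n] with η h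
      simp [h]
  add_mem' := by
    rintro p q ⟨hp1, hp2⟩ ⟨hq1, hq2⟩
    refine ⟨fun n => ?_, fun n => ?_⟩
    · filter_upwards [hat_add_ae (p 0) (q 0) n, hat_add_ae (p 1) (q 1) n, hp1 n, hq1 n]
        with η h0 h1 h2 h3
      simp only [PiLp.add_apply]
      rw [h0, h1, h2, h3]
      ring
    · filter_upwards [hat_add_ae (p 0) (q 0) n, hat_add_ae (p 2) (q 2) n, hp2 n, hq2 n]
        with η h0 h1 h2 h3
      simp only [PiLp.add_apply]
      rw [h0, h1, h2, h3]
      ring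
  smul_mem' := by
    rintro a p ⟨hp1, hp2⟩
    refine ⟨fun n => ?_, fun n => ?_⟩
    · filter_upwards [hat_smul_ae a (p 0) n, hat_smul_ae a (p 1) n, hp1 n] with η h0 h1 h2
      simp only [PiLp.smul_apply]
      rw [h0, h1, h2]
      ring
    · filter_upwards [hat_smul_ae a (p 0) n, hat_smul_ae a (p 2) n, hp2 n] with η h0 h1 h2
      simp only [PiLp.smul_apply]
      rw [h0, h1, h2]
      ring

variable (𝕜) in
/-- The normed space `𝓔(ℝ × 𝕋)`. -/
abbrev E : Type _ := energySpace 𝕜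

variable (𝕜) in
/-- The inclusion `u ↦ u` of `𝓔` in `L²`. -/
def incl : E 𝕜 →L[𝕜] L2 𝕜 := (PiLp.proj 2 (fun _ : Fin 3 => L2 𝕜) 0).comp (energySpace 𝕜).subtypeL

variable (𝕜) in
/-- `u ↦ ∂_x u`, from `𝓔` to `L²`. -/
def dx : E 𝕜 →L[𝕜] L2 𝕜 := (PiLp.proj 2 (fun _ : Fin 3 => L2 𝕜) 1).comp (energySpace 𝕜).subtypeL

variable (𝕜) in
/-- `u ↦ ∂_x^{-1} ∂_y u`, from `𝓔` to `L²`. -/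
def dxInvDy : E 𝕜 →L[𝕜] L2 𝕜 :=
  (PiLp.proj 2 (fun _ : Fin 3 => L2 𝕜) 2).comp (energySpace 𝕜).subtypeL

lemma norm_sq_E (w : E 𝕜) :
    ‖w‖ ^ 2 = ‖incl 𝕜 w‖ ^ 2 + ‖dx 𝕜 w‖ ^ 2 + ‖dxInvDy 𝕜 w‖ ^ 2 := by
  change ‖(w : PiLp 2 (fun _ : Fin 3 => L2 𝕜))‖ ^ 2 = _
  rw [PiLp.norm_sq_eq_of_L2, Fin.sum_univ_three]
  rfl

/-- The Fourier description of the norm: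
`‖u‖_𝓔² = ∑ₙ ∫ (1 + ξ² + ξ⁻² n²) |û(ξ, n)|² dξ`, with `ξ = 2πη`. -/
lemma enorm_sq_E (w : E 𝕜) :
    ‖w‖ₑ ^ 2 = ∑' n : ℤ, ∫⁻ η : ℝ,
      ENNReal.ofReal (1 + (2 * π * η) ^ 2 + ((2 * π * η) ^ 2)⁻¹ * (n : ℝ) ^ 2) *
        ‖hat (incl 𝕜 w) n η‖ₑ ^ 2 := by
  have h0 : ‖w‖ₑ ^ 2 = ‖incl 𝕜 w‖ₑ ^ 2 + ‖dx 𝕜 w‖ₑ ^ 2 + ‖dxInvDy 𝕜 w‖ₑ ^ 2 := by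
    simp only [← ofReal_norm, ← ENNReal.ofReal_pow (norm_nonneg _)]
    rw [norm_sq_E, ENNReal.ofReal_add (by positivity) (by positivity),
      ENNReal.ofReal_add (by positivity) (by positivity)]
  have hm (u : L2 𝕜) (n : ℤ) : AEMeasurable (fun η : ℝ => ‖hat u n η‖ₑ ^ 2) :=
    (Lp.aestronglyMeasurable (hat u n)).enorm.pow_const 2
  rw [h0, ← plancherel, ← plancherel, ← plancherel, ← ENNReal.tsum_add, ← ENNReal.tsum_add]
  congr 1
  ext n
  rw [← lintegral_add_left' (hm _ n), ← lintegral_add_left' (by exact (hm _ n).add (hm _ n))]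
  apply lintegral_congr_ae
  filter_upwards [w.2.1 n, w.2.2 n] with η h1 h2
  have e1 : hat (dx 𝕜 w) n η = (Complex.I * (2 * π * η)) * hat (incl 𝕜 w) n η := h1
  have e2 : hat (dxInvDy 𝕜 w) n η =
    (Complex.I * (2 * π * η))⁻¹ * ((Complex.I * n) * hat (incl 𝕜 w) n η) := h2
  rw [e1, e2]
  simp only [← ofReal_norm, ← ENNReal.ofReal_pow (norm_nonneg _)]
  rw [← ENNReal.ofReal_mul (by positivity), ← ENNReal.ofReal_add (by positivity) (by positivity),
    ← ENNReal.ofReal_add (by positivity) (by positivity)]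
  congr 1
  simp only [norm_mul, norm_inv, Complex.norm_I, Complex.norm_real, Complex.norm_intCast,
    Complex.norm_ofNat, Real.norm_eq_abs, mul_pow, inv_pow, sq_abs]
  ring

/-- An element of `𝓔` is determined by the underlying function in `L²`. -/
lemma incl_injective : Function.Injective (incl 𝕜) := by
  rw [injective_iff_map_eq_zero]
  intro w hw
  have h := enorm_sq_E w
  rw [hw] at h
  have h0 (n : ℤ) : ∫⁻ η : ℝ,
      ENNReal.ofReal (1 + (2 * π * η) ^ 2 + ((2 * π * η) ^ 2)⁻¹ * (n : ℝ) ^ 2) *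
        ‖hat (0 : L2 𝕜) n η‖ₑ ^ 2 = 0 := by
    rw [lintegral_congr_ae (g := fun _ => 0)]
    · simp
    · filter_upwards [hat_zero_ae (𝕜 := 𝕜) n] with η hη
      simp [hη]
  simp_rw [h0] at h
  have hw0 : ‖w‖ₑ = 0 := by simpa using h
  exact enorm_eq_zero.1 hw0

/-! ### The line soliton, the kink, and the linearized Miura operators -/

/-- `Q_c(x) = (c/2)^{1/2} tanh((c/2)^{1/2} x)`. -/
def kink (c x : ℝ) : ℝ := Real.sqrt (c / 2) * Real.tanh (Real.sqrt (c / 2) * x)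

/-- `φ_c(x) = c cosh^{-2}((c/2)^{1/2} x)`. -/
def soliton (c x : ℝ) : ℝ := c * (Real.cosh (Real.sqrt (c / 2) * x) ^ 2)⁻¹

lemma abs_kink_le (c x : ℝ) : |kink c x| ≤ Real.sqrt (c / 2) := by
  rw [kink, abs_mul, abs_of_nonneg (Real.sqrt_nonneg _)]
  exact mul_le_of_le_one_right (Real.sqrt_nonneg _) (Real.abs_tanh_lt_one _).le

lemma memLp_kink_mul (c : ℝ) (u : L2 𝕜) :
    MemLp (fun p : ℝ × Torus => (kink c p.1 : 𝕜) * u p) 2 volume := by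
  have hc : Measurable (fun p : ℝ × Torus => (kink c p.1 : 𝕜)) := by
    have : Continuous (kink c) := by
      unfold kink
      simp only [Real.tanh_eq_sinh_div_cosh]
      refine continuous_const.mul (Continuous.div (by fun_prop) (by fun_prop) ?_)
      exact fun x => (Real.cosh_pos _).ne'
    exact (RCLike.continuous_ofReal.comp (this.comp continuous_fst)).measurable
  refine (Lp.memLp u).of_le_mul (c := Real.sqrt (c / 2))
    (hc.aestronglyMeasurable.mul (Lp.aestronglyMeasurable u)) ?_
  filter_upwards with p
  rw [norm_mul, RCLike.norm_ofReal]
  exact mul_le_mul_of_nonneg_right (abs_kink_le c p.1) (norm_nonneg _)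

variable (𝕜) in
/-- Multiplication by `Q_c(x)` on `L²(ℝ × 𝕋)`. -/
def mulKink (c : ℝ) : L2 𝕜 →L[𝕜] L2 𝕜 :=
  LinearMap.mkContinuous
    { toFun := fun u => (memLp_kink_mul c u).toLp
      map_add' := by
        intro u v
        rw [← MemLp.toLp_add, MemLp.toLp_eq_toLp_iff]
        filter_upwards [Lp.coeFn_add u v] with p hp
        simp only [Pi.add_apply, hp]
        ring
      map_smul' := by
        intro a u
        rw [← MemLp.toLp_const_smul, MemLp.toLp_eq_toLp_iff]
        filter_upwards [Lp.coeFn_smul a u] with p hp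
        simp only [Pi.smul_apply, RingHom.id_apply, hp, smul_eq_mul]
        ring }
    (Real.sqrt (c / 2)) (by
      intro u
      refine Lp.norm_le_mul_norm_of_ae_le_mul ?_
      filter_upwards [(memLp_kink_mul c u).coeFn_toLp] with p hp
      change ‖((memLp_kink_mul c u).toLp : ℝ × Torus → 𝕜) p‖ ≤ _
      rw [hp, norm_mul, RCLike.norm_ofReal]
      exact mul_le_mul_of_nonneg_right (abs_kink_le c p.1) (norm_nonneg _))

variable (𝕜) in
/-- `L_c = ∂_x + ∂_x^{-1} ∂_y - 2 Q_c(x)` as a bounded operator from `𝓔` to `L²`. -/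
def opL (c : ℝ) : E 𝕜 →L[𝕜] L2 𝕜 :=
  dx 𝕜 + dxInvDy 𝕜 - (2 : 𝕜) • (mulKink 𝕜 c).comp (incl 𝕜)

variable (𝕜) in
/-- `𝓛_c = -∂_x + ∂_x^{-1} ∂_y - 2 Q_c(x)` as a bounded operator from `𝓔` to `L²`. -/
def opLAdj (c : ℝ) : E 𝕜 →L[𝕜] L2 𝕜 :=
  -dx 𝕜 + dxInvDy 𝕜 - (2 : 𝕜) • (mulKink 𝕜 c).comp (incl 𝕜)

variable (𝕜) in
lemma memLp_soliton {c : ℝ} (hc : 0 < c) :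
    MemLp (fun p : ℝ × Torus => (soliton c p.1 : 𝕜)) 2 volume := by
  have hcont : Continuous (soliton c) := by
    unfold soliton
    refine continuous_const.mul (Continuous.inv₀ (by fun_prop) ?_)
    exact fun x => (pow_pos (Real.cosh_pos _) 2).ne'
  have ha : 0 < Real.sqrt (c / 2) := Real.sqrt_pos.2 (by positivity)
  have h1 : MemLp (soliton c) 2 volume := by
    rw [memLp_two_iff_integrable_sq_norm hcont.aestronglyMeasurable]
    have hi : Integrable (fun x : ℝ => c ^ 2 * (1 + (Real.sqrt (c / 2) * x) ^ 2)⁻¹) :=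
      (integrable_inv_one_add_sq.comp_mul_left' ha.ne').const_mul _
    refine hi.mono' (hcont.norm.pow 2).aestronglyMeasurable ?_
    filter_upwards with x
    set t := Real.sqrt (c / 2) * x
    have hs : t ^ 2 ≤ Real.sinh t ^ 2 := by
      rw [sq_le_sq]
      rw [Real.abs_sinh]
      exact Real.self_le_sinh_iff.2 (abs_nonneg t)
    have hch : 1 + t ^ 2 ≤ Real.cosh t ^ 2 := by rw [Real.cosh_sq]; linarith
    have hA : (Real.cosh t ^ 2)⁻¹ ≤ (1 + t ^ 2)⁻¹ := inv_anti₀ (by positivity) hch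
    have hB : (Real.cosh t ^ 2)⁻¹ ≤ 1 := inv_le_one_of_one_le₀ (by nlinarith [sq_nonneg t])
    have hC : 0 ≤ (Real.cosh t ^ 2)⁻¹ := by positivity
    rw [norm_pow, norm_norm, Real.norm_eq_abs, sq_abs, soliton, mul_pow]
    refine mul_le_mul_of_nonneg_left ?_ (by positivity)
    calc ((Real.cosh t ^ 2)⁻¹) ^ 2 = (Real.cosh t ^ 2)⁻¹ * (Real.cosh t ^ 2)⁻¹ := sq _
      _ ≤ (1 + t ^ 2)⁻¹ * 1 := mul_le_mul hA hB hC (by positivity)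
      _ = _ := mul_one _
  have h2 : MemLp (fun p : ℝ × Torus => soliton c p.1) 2
      ((volume : Measure ℝ).prod (volume : Measure Torus)) := h1.comp_fst _
  exact h2.ofReal

variable (𝕜) in
/-- The line soliton `(x, y) ↦ φ_c(x)` as an element of `L²(ℝ × 𝕋)`. -/
def solitonL2 {c : ℝ} (hc : 0 < c) : L2 𝕜 := (memLp_soliton 𝕜 hc).toLp

end Fourier

end KPII

/-! The coefficient $Q_c$ depends on $x$ only, so $L_c$ commutes with the mean in $y$, the
projection `mean` onto the mode $n=0$. The two blocks behave quite differently.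

On the zero mode, $L_c$ is the ordinary differential operator $\partial_x-2Q_c$. The Riccati
equation $Q'=c/2-Q^2$ and one integration by parts give $\|z'-2Qz\|^2=\|z'\|^2+2\|Qz\|^2+c\|z\|^2$,
hence the lower bound `norm_mean_incl_le`. The cokernel lives here: $\varphi_c'=-2Q_c\varphi_c$ puts
$\varphi_c$ in the kernel of the adjoint. Conversely, $(\partial_x-2Q_c)(\cosh^2\psi)=\cosh^2\psi'$
(argument $\sqrt{c/2}\,x$) forces every zero mode orthogonal to the range to be a multiple of
$\cosh^{-2}$ (`eq_zero_of_orthogonal`).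

On the nonzero modes $L_c$ is bijective. The family `opHom` multiplies the kink by $t\in[0,1]$
there, and on the zero mode replaces $Q_c$ by the harmless term $P$. At $t=0$ it is a Fourier
multiplier with symbol at least $1$ in modulus. The a priori bound is available directly only for
the adjoint, $s=-1$: pair with $g=\partial_x^{-1}(1-P)v$. Then $-\partial_x v$ contributes
$\|g'\|^2$, the multiplier $\partial_x^{-1}\partial_y$ contributes nothing to the real part, and
$-2tQg'$ contributes $t\,(c/2\,\|g\|^2-\|Qg\|^2)\ge0$ (`norm_sub_mean_sq_le`). The method of
continuity makes the adjoint family onto; duality then bounds the family $s=1$ from below, and a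
second continuity argument makes it onto.

Together the two blocks bound $L_c$ from below, so its kernel is trivial and its range closed. The
range lies in $\varphi_c^\perp$, and nothing in $\varphi_c^\perp$ is orthogonal to it, so they
coincide; the kernel of $\mathcal L_c$ and the Fredholm property follow. -/

namespace KPII

open scoped SchwartzMap

/-! ### Fourier transform, weak derivatives and conjugation in $L^2(\mathbb R)$ -/

/-- A locally integrable function on `ℝ` vanishes if all its integrals against Schwartz functions
arising from real bump functions vanish. -/
lemma ae_eq_of_forall_schwartz {f g : ℝ → ℂ} (hf : LocallyIntegrable f) (hg : LocallyIntegrable g)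
    (h : ∀ χ : 𝓢(ℝ, ℂ), (∀ x, (starRingEnd ℂ) (χ x) = χ x) → HasCompactSupport χ →
      ∫ x, χ x * f x = ∫ x, χ x * g x) : ∀ᵐ x, f x = g x := by
  apply ae_eq_of_integral_contDiff_smul_eq hf hg
  intro ψ hψ hc
  have h1 : HasCompactSupport (Complex.ofRealCLM ∘ ψ) := hc.comp_left rfl
  have h2 : ContDiff ℝ (↑(⊤ : ℕ∞)) (Complex.ofRealCLM ∘ ψ) := by fun_prop
  have := h (h1.toSchwartzMap h2) (fun x => by simp) h1
  simpa using this

lemma integral_mul_fourier (χ : 𝓢(ℝ, ℂ)) (f : Lp ℂ 2 (volume : Measure ℝ)) :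
    ∫ x, χ x * (𝓕 f : Lp ℂ 2 (volume : Measure ℝ)) x = ∫ x, (𝓕 χ : 𝓢(ℝ, ℂ)) x * f x := by
  have h := congrArg (fun T => T χ) (Lp.fourier_toTemperedDistribution_eq f)
  simpa using h.symm

lemma locallyIntegrable_Lp (f : Lp ℂ 2 (volume : Measure ℝ)) : LocallyIntegrable f :=
  (Lp.memLp f).locallyIntegrable one_le_two

lemma integrable_schwartz_mul (χ : 𝓢(ℝ, ℂ)) (f : Lp ℂ 2 (volume : Measure ℝ)) :
    Integrable (fun x => χ x * f x) :=
  (χ.memLp 2).integrable_mul (Lp.memLp f)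

/-- `v` is the weak derivative of `u`, for `u, v ∈ L²(ℝ)`. -/
def IsWeakDeriv (u v : Lp ℂ 2 (volume : Measure ℝ)) : Prop :=
  ∀ χ : 𝓢(ℝ, ℂ), ∫ x, deriv χ x * u x = -∫ x, χ x * v x

/-- The Fourier description of $\partial_x$ is opaque to multiplication by $Q_c$; testing against
Schwartz functions is not. This equivalence is the bridge between the two, and rests on transposing
$\mathcal F$ onto the test function. -/
lemma fourier_eq_mul_iff (u v : Lp ℂ 2 (volume : Measure ℝ)) :
    (∀ᵐ η : ℝ, (𝓕 v : Lp ℂ 2 (volume : Measure ℝ)) η =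
      (Complex.I * (2 * π * η)) * (𝓕 u : Lp ℂ 2 (volume : Measure ℝ)) η) ↔ IsWeakDeriv u v := by
  have hT : (fun η : ℝ => Complex.I * (2 * π * η)).HasTemperateGrowth := by fun_prop
  -- the Fourier transform of `iξ χ` is `-(𝓕 χ)'`
  have key (χ : 𝓢(ℝ, ℂ)) (x : ℝ) :
      (𝓕 (SchwartzMap.smulLeftCLM ℂ (fun η : ℝ => Complex.I * (2 * π * η)) χ)) x =
      -deriv (𝓕 χ : 𝓢(ℝ, ℂ)) x := by
    have h := congrArg (fun f : 𝓢(ℝ, ℂ) => f x) (SchwartzMap.lineDerivOp_fourier_eq χ (1 : ℝ))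
    simp only [SchwartzMap.lineDerivOp_apply_eq_fderiv, fderiv_apply_one_eq_deriv] at h
    rw [h, ← neg_apply, ← FourierTransform.fourier_neg]
    congr 2
    ext η
    rw [SchwartzMap.smulLeftCLM_apply_apply hT]
    simp only [smul_apply, neg_smul, smul_eq_mul, neg_neg]
    rw [SchwartzMap.smulLeftCLM_apply_apply (by fun_prop)]
    simp
    ring
  have hmul (χ : 𝓢(ℝ, ℂ)) : -∫ x, deriv (𝓕 χ : 𝓢(ℝ, ℂ)) x * u x =
      ∫ η, χ η * ((Complex.I * (2 * π * η)) * (𝓕 u : Lp ℂ 2 (volume : Measure ℝ)) η) := by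
    have := integral_mul_fourier
      (SchwartzMap.smulLeftCLM ℂ (fun η : ℝ => Complex.I * (2 * π * η)) χ) u
    simp only [key, SchwartzMap.smulLeftCLM_apply_apply hT, smul_eq_mul, neg_mul,
      integral_neg] at this
    rw [← this]
    congr 1
    ext x
    ring
  constructor
  · intro h χ
    -- Every Schwartz function is a Fourier transform, so the identity `hmul` reaches an arbitrary
    -- `χ`.
    have h1 := hmul (𝓕⁻ χ)
    have h2 := integral_mul_fourier (𝓕⁻ χ) v
    rw [FourierTransform.fourier_fourierInv_eq] at h1 h2
    rw [eq_neg_iff_add_eq_zero, ← h2, ← neg_eq_zero, neg_add, h1, ← sub_eq_add_neg, sub_eq_zero]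
    apply integral_congr_ae
    filter_upwards [h] with η hη
    rw [hη]
  · intro h
    refine ae_eq_of_forall_schwartz (locallyIntegrable_Lp _) ?_ fun χ _ _ => ?_
    · exact (locallyIntegrable_Lp _).continuous_mul (by fun_prop)
    · rw [← hmul, integral_mul_fourier, h, neg_neg]

/-- The Fourier transform of the conjugate. -/
lemma fourier_conj {u v : Lp ℂ 2 (volume : Measure ℝ)}
    (h : ∀ᵐ x, v x = (starRingEnd ℂ) (u x)) :
    ∀ᵐ η : ℝ, (𝓕 v : Lp ℂ 2 (volume : Measure ℝ)) η =
      (starRingEnd ℂ) ((𝓕 u : Lp ℂ 2 (volume : Measure ℝ)) (-η)) := by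
  have hneg : MeasurePreserving (fun x : ℝ => -x) volume volume :=
    Measure.measurePreserving_neg volume
  have hm : MemLp (fun η : ℝ => (starRingEnd ℂ) ((𝓕 u : Lp ℂ 2 (volume : Measure ℝ)) (-η))) 2
      volume := ((Lp.memLp (𝓕 u)).comp_measurePreserving hneg).star
  refine ae_eq_of_forall_schwartz (locallyIntegrable_Lp _) (hm.locallyIntegrable one_le_two)
    fun χ hχ _ => ?_
  -- The reflection of `χ`. Since `χ` is real, conjugating the transform of the reflection returns
  -- the transform of `χ`.
  set χ' : 𝓢(ℝ, ℂ) := SchwartzMap.compCLMOfContinuousLinearEquiv ℂ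
    (ContinuousLinearEquiv.neg ℝ (M := ℝ)) χ with hχ'
  have e (x : ℝ) : χ' x = χ (-x) := rfl
  have e2 (x : ℝ) : (𝓕 χ : 𝓢(ℝ, ℂ)) x = (starRingEnd ℂ) ((𝓕 χ' : 𝓢(ℝ, ℂ)) x) := by
    simp only [SchwartzMap.fourier_coe, Real.fourier_eq', ← integral_conj]
    rw [← integral_neg_eq_self]
    congr 1
    ext y
    simp only [e, smul_eq_mul, map_mul, ← Complex.exp_conj, hχ, Complex.conj_I,
      Complex.conj_ofReal]
    simp
  rw [integral_mul_fourier]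
  have e3 : ∫ x, (𝓕 χ : 𝓢(ℝ, ℂ)) x * v x = (starRingEnd ℂ) (∫ x, (𝓕 χ' : 𝓢(ℝ, ℂ)) x * u x) := by
    rw [← integral_conj]
    apply integral_congr_ae
    filter_upwards [h] with x hx
    rw [map_mul, ← e2, hx]
  rw [e3, ← integral_mul_fourier, ← integral_conj, ← integral_neg_eq_self]
  congr 1
  ext x
  simp [e, hχ]

/-- A square integrable derivative of a square integrable function is its weak derivative. -/
lemma isWeakDeriv_of_hasDerivAt {f f' : ℝ → ℂ} (hf : ∀ x, HasDerivAt f (f' x) x)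
    {u v : Lp ℂ 2 (volume : Measure ℝ)} (hu : ∀ᵐ x, u x = f x) (hv : ∀ᵐ x, v x = f' x) :
    IsWeakDeriv u v := by
  intro χ
  have e1 : ∀ᵐ x, deriv χ x * u x = deriv χ x * f x := by
    filter_upwards [hu] with x hx
    rw [hx]
  have e2 : ∀ᵐ x, χ x * v x = χ x * f' x := by
    filter_upwards [hv] with x hx
    rw [hx]
  have e3 : ∀ᵐ x, χ x * u x = χ x * f x := by
    filter_upwards [hu] with x hx
    rw [hx]
  have h := integral_mul_deriv_eq_deriv_mul_of_integrable (u := χ) (v := f)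
    (fun x _ => χ.hasDerivAt x) (fun x _ => hf x)
    ((integrable_congr e2).1 (integrable_schwartz_mul χ v))
    ((integrable_congr e1).1 (integrable_schwartz_mul (SchwartzMap.derivCLM ℂ ℂ χ) u))
    ((integrable_congr e3).1 (integrable_schwartz_mul χ u))
  rw [integral_congr_ae e1, integral_congr_ae e2, h, neg_neg]

/-! ### Calculus of the kink -/

lemma hasDerivAt_tanh (x : ℝ) : HasDerivAt Real.tanh (1 - Real.tanh x ^ 2) x := by
  have h := (Real.hasDerivAt_sinh x).div (Real.hasDerivAt_cosh x) (Real.cosh_pos x).ne'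
  have e : Real.tanh = Real.sinh / Real.cosh := by
    ext y
    exact Real.tanh_eq_sinh_div_cosh y
  rw [e]
  refine h.congr_deriv ?_
  have := (Real.cosh_pos x).ne'
  simp only [Pi.div_apply]
  field_simp

/-- The Riccati equation $Q'=c/2-Q^2$, the only property of the kink behind the energy estimates
besides $|Q|\le\sqrt{c/2}$. -/
lemma hasDerivAt_kink {c : ℝ} (hc : 0 ≤ c) (x : ℝ) :
    HasDerivAt (kink c) (c / 2 - kink c x ^ 2) x := by
  have h := ((hasDerivAt_tanh (Real.sqrt (c / 2) * x)).comp x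
    ((hasDerivAt_id x).const_mul (Real.sqrt (c / 2)))).const_mul (Real.sqrt (c / 2))
  refine h.congr_deriv ?_
  have := Real.sq_sqrt (show 0 ≤ c / 2 by positivity)
  simp only [kink, mul_pow, this]
  linear_combination (1 - Real.tanh (Real.sqrt (c / 2) * x) ^ 2) * this

lemma continuous_kink {c : ℝ} (hc : 0 ≤ c) : Continuous (kink c) :=
  continuous_iff_continuousAt.2 fun x => (hasDerivAt_kink hc x).continuousAt

-- By the Riccati equation, differentiating $p(Q)$ gives $p'(Q)(c/2-Q^2)$, again a polynomial in
-- $Q$. As $Q$ is bounded, so are all its derivatives.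
open Polynomial in
lemma exists_iteratedDeriv_kink {c : ℝ} (hc : 0 ≤ c) (n : ℕ) :
    ∃ p : ℝ[X], iteratedDeriv n (kink c) = fun x => p.eval (kink c x) := by
  induction n with
  | zero => exact ⟨X, by simp⟩
  | succ n ih =>
    obtain ⟨p, hp⟩ := ih
    refine ⟨p.derivative * (C (c / 2) - X ^ 2), ?_⟩
    rw [iteratedDeriv_succ, hp]
    ext x
    have := ((p.hasDerivAt (kink c x)).comp x (hasDerivAt_kink hc x)).deriv
    simpa [Function.comp_def] using this

lemma contDiff_kink (c : ℝ) : ContDiff ℝ (↑(⊤ : ℕ∞)) (kink c) := by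
  have e : kink c = fun x => Real.sqrt (c / 2) *
      (Real.sinh (Real.sqrt (c / 2) * x) / Real.cosh (Real.sqrt (c / 2) * x)) := by
    ext x
    rw [kink, Real.tanh_eq_sinh_div_cosh]
  rw [e]
  refine contDiff_const.mul (ContDiff.div (by fun_prop) (by fun_prop) ?_)
  exact fun x => (Real.cosh_pos _).ne'

/-- Temperate growth keeps $Q\chi$ in the Schwartz class, so in the product rule the kink can be
moved onto the test function. -/
lemma hasTemperateGrowth_kink {c : ℝ} (hc : 0 ≤ c) :
    (fun x : ℝ => (kink c x : ℂ)).HasTemperateGrowth := by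
  have h : (kink c).HasTemperateGrowth := by
    refine ⟨contDiff_kink c, fun n => ?_⟩
    obtain ⟨p, hp⟩ := exists_iteratedDeriv_kink hc n
    have hK := (isCompact_Icc (a := -Real.sqrt (c / 2)) (b := Real.sqrt (c / 2)))
    obtain ⟨C, hC⟩ := hK.exists_bound_of_continuousOn p.continuous.continuousOn
    refine ⟨0, C, fun x => ?_⟩
    rw [norm_iteratedFDeriv_eq_norm_iteratedDeriv, hp, pow_zero, mul_one]
    exact hC _ (abs_le.1 (abs_kink_le c x))
  exact Function.HasTemperateGrowth.comp Function.Complex.hasTemperateGrowth_ofReal h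

/-- The product rule for multiplication by the kink. -/
lemma IsWeakDeriv.kink_mul {c : ℝ} (hc : 0 ≤ c) {u v p q : Lp ℂ 2 (volume : Measure ℝ)}
    (h : IsWeakDeriv u v) (hp : ∀ᵐ x, p x = kink c x * u x)
    (hq : ∀ᵐ x, q x = kink c x * v x + (c / 2 - kink c x ^ 2) * u x) : IsWeakDeriv p q := by
  intro χ
  have hT := hasTemperateGrowth_kink hc
  set χ₁ : 𝓢(ℝ, ℂ) := SchwartzMap.smulLeftCLM ℂ (fun x : ℝ => (kink c x : ℂ)) χ with h₁
  set χ₂ : 𝓢(ℝ, ℂ) :=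
    SchwartzMap.smulLeftCLM ℂ (fun x : ℝ => (c / 2 - kink c x ^ 2 : ℂ)) χ with h₂
  have hT2 : (fun x : ℝ => (c / 2 - kink c x ^ 2 : ℂ)).HasTemperateGrowth := by
    have := hT.pow 2
    exact (Function.HasTemperateGrowth.const _).sub this
  have e₁ (x : ℝ) : χ₁ x = kink c x * χ x := SchwartzMap.smulLeftCLM_apply_apply hT _ _
  have e₂ (x : ℝ) : χ₂ x = (c / 2 - kink c x ^ 2) * χ x :=
    SchwartzMap.smulLeftCLM_apply_apply hT2 _ _
  have d₁ (x : ℝ) : deriv χ₁ x = χ₂ x + kink c x * deriv χ x := by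
    have h1 := (hasDerivAt_kink hc x).ofReal_comp.mul (χ.hasDerivAt x)
    have h2 : (χ₁ : ℝ → ℂ) = (fun y : ℝ => (kink c y : ℂ)) * χ := funext e₁
    rw [h2, h1.deriv, e₂]
    push_cast
    ring
  have i1 : ∫ x, deriv χ x * p x = ∫ x, (deriv χ₁ x * u x - χ₂ x * u x) := by
    apply integral_congr_ae
    filter_upwards [hp] with x hx
    rw [hx, d₁]
    ring
  have i2 : ∫ x, χ x * q x = ∫ x, (χ₁ x * v x + χ₂ x * u x) := by
    apply integral_congr_ae
    filter_upwards [hq] with x hx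
    rw [hx, e₁, e₂]
    ring
  have i3 : Integrable (fun x => deriv χ₁ x * u x) :=
    integrable_schwartz_mul (SchwartzMap.derivCLM ℂ ℂ χ₁) u
  rw [i1, i2, integral_sub i3
    (integrable_schwartz_mul _ _), integral_add (integrable_schwartz_mul _ _)
    (integrable_schwartz_mul _ _), h χ₁]
  ring

variable {𝕜 : Type*} [RCLike 𝕜]

/-! ### Parseval's identity -/

lemma hasSum_norm_sq_hat (u : L2 𝕜) : HasSum (fun n : ℤ => ‖hat u n‖ ^ 2) (‖u‖ ^ 2) := by
  have h := plancherel u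
  simp_rw [← enorm_sq_eq_lintegral] at h
  simp only [← ofReal_norm, ← ENNReal.ofReal_pow (norm_nonneg _)] at h
  have hs : Summable (fun n : ℤ => ‖hat u n‖ ^ 2) := by
    have h1 : ∑' n : ℤ, ENNReal.ofReal (‖hat u n‖ ^ 2) ≠ ∞ := by
      rw [h]
      exact ENNReal.ofReal_ne_top
    have h2 := ENNReal.summable_toReal h1
    refine h2.congr fun n => ?_
    rw [ENNReal.toReal_ofReal (by positivity)]
  rw [← ENNReal.ofReal_tsum_of_nonneg (fun n => by positivity) hs,
    ENNReal.ofReal_eq_ofReal_iff (tsum_nonneg fun n => by positivity) (by positivity)] at h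
  rw [← h]
  exact hs.hasSum

lemma hat_sub (u v : L2 𝕜) (n : ℤ) : hat (u - v) n = hat u n - hat v n := by
  have h := hat_add (u - v) v n
  rw [sub_add_cancel] at h
  rw [h, add_sub_cancel_right]

lemma norm_hat_le (u : L2 𝕜) (n : ℤ) : ‖hat u n‖ ≤ ‖u‖ := by
  rw [← sq_le_sq₀ (norm_nonneg _) (norm_nonneg _)]
  exact le_hasSum (hasSum_norm_sq_hat u) n (fun _ _ => by positivity)

lemma hat_injective {u v : L2 𝕜} (h : ∀ n, hat u n = hat v n) : u = v := by
  have h1 := hasSum_norm_sq_hat (u - v)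
  simp only [hat_sub, h, sub_self, norm_zero, ne_eq, OfNat.ofNat_ne_zero, not_false_eq_true,
    zero_pow] at h1
  have h2 := h1.unique hasSum_zero
  rwa [pow_eq_zero_iff two_ne_zero, norm_eq_zero, sub_eq_zero] at h2

lemma hat_ae_injective {u v : L2 𝕜} (h : ∀ n, ∀ᵐ η, hat u n η = hat v n η) : u = v :=
  hat_injective fun n => Lp.ext (h n)

/-- Polarization of Plancherel. Only real parts are compared, because the inner product of $L^2$
takes values in `𝕜` while that of the modes is complex. -/
lemma hasSum_re_inner_hat (u v : L2 𝕜) :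
    HasSum (fun n : ℤ => RCLike.re (inner ℂ (hat u n) (hat v n))) (RCLike.re (inner 𝕜 u v)) := by
  have h := ((hasSum_norm_sq_hat (u + v)).sub (hasSum_norm_sq_hat (u - v))).div_const 4
  simp only [hat_add, hat_sub] at h
  rw [re_inner_eq_norm_add_mul_self_sub_norm_sub_mul_self_div_four]
  simp_rw [re_inner_eq_norm_add_mul_self_sub_norm_sub_mul_self_div_four, ← sq]
  exact h

/-- Real parts of inner products agree if they do so at every frequency. -/
lemma re_inner_eq_of_hat {u v u' v' : L2 𝕜}
    (h : ∀ n, ∀ᵐ η, (hat v n η * (starRingEnd ℂ) (hat u n η)).re =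
      (hat v' n η * (starRingEnd ℂ) (hat u' n η)).re) :
    RCLike.re (inner 𝕜 u v) = RCLike.re (inner 𝕜 u' v') := by
  have e (n : ℤ) : RCLike.re (inner ℂ (hat u n) (hat v n)) =
      RCLike.re (inner ℂ (hat u' n) (hat v' n)) := by
    have i (f g : Lp ℂ 2 (volume : Measure ℝ)) : RCLike.re (inner ℂ f g) =
        ∫ η, (g η * (starRingEnd ℂ) (f η)).re := by
      rw [MeasureTheory.L2.inner_def, ← integral_re (MeasureTheory.L2.integrable_inner f g)]
      rfl
    rw [i, i]
    exact integral_congr_ae (h n)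
  have h1 := hasSum_re_inner_hat u v
  simp_rw [e] at h1
  exact h1.unique (hasSum_re_inner_hat u' v')

/-- Take $a=\overline{z-w}$. This recovers full inner products from their real parts, by linearity
in the second argument. -/
lemma rclike_eq_of_re_mul {z w : 𝕜} (h : ∀ a : 𝕜, RCLike.re (a * z) = RCLike.re (a * w)) :
    z = w := by
  have h1 := h ((starRingEnd 𝕜) (z - w))
  rw [← sub_eq_zero, ← map_sub, ← mul_sub, RCLike.conj_mul, ← RCLike.ofReal_pow,
    RCLike.ofReal_re, pow_eq_zero_iff two_ne_zero, norm_eq_zero, sub_eq_zero] at h1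
  exact h1

/-- Inner products agree if they do so at every frequency. -/
lemma inner_eq_of_hat {u v u' v' : L2 𝕜}
    (h : ∀ n, ∀ᵐ η, hat v n η * (starRingEnd ℂ) (hat u n η) =
      hat v' n η * (starRingEnd ℂ) (hat u' n η)) : inner 𝕜 u v = inner 𝕜 u' v' := by
  refine rclike_eq_of_re_mul fun a => ?_
  rw [← inner_smul_right, ← inner_smul_right]
  refine re_inner_eq_of_hat fun n => ?_
  filter_upwards [h n, hat_smul_ae a v n, hat_smul_ae a v' n] with η h1 h2 h3
  rw [h2, h3, mul_assoc, h1, mul_assoc]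

/-- A pointwise bound of Fourier transforms bounds norms. -/
lemma norm_le_of_hat {u v : L2 𝕜} {B : ℝ}
    (h : ∀ n, ∀ᵐ η, ‖hat u n η‖ ≤ B * ‖hat v n η‖) (hB : 0 ≤ B) : ‖u‖ ≤ B * ‖v‖ := by
  rw [← sq_le_sq₀ (norm_nonneg _) (by positivity), mul_pow]
  refine hasSum_le (fun n => ?_) (hasSum_norm_sq_hat u) ((hasSum_norm_sq_hat v).mul_left (B ^ 2))
  rw [← mul_pow]
  exact pow_le_pow_left₀ (norm_nonneg _) (Lp.norm_le_mul_norm_of_ae_le_mul (h n)) 2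

/-! ### Fourier synthesis -/

lemma integral_fourier_mul_fourier (n k : ℤ) :
    ∫ y : Torus, fourier (-k) y * fourier n y = if k = n then ((2 * π : ℝ) : ℂ) else 0 := by
  have h := congrFun (fourierCoeff_fourier (T := 2 * π) n) k
  rw [fourierCoeff, AddCircle.integral_haarAddCircle] at h
  have hpi : (2 * π : ℝ) ≠ 0 := Real.two_pi_pos.ne'
  simp only [smul_eq_mul] at h
  rw [inv_smul_eq_iff₀ hpi] at h
  rw [h, Pi.single_apply]
  split_ifs <;> simp

lemma memLp_mul_fourier (h : Lp ℂ 2 (volume : Measure ℝ)) (n : ℤ) :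
    MemLp (fun p : ℝ × Torus => ((Real.sqrt (2 * π))⁻¹ : ℂ) * (h p.1 * fourier n p.2)) 2
      volume := by
  have h1 : MemLp (fun p : ℝ × Torus => h p.1) 2
    ((volume : Measure ℝ).prod (volume : Measure Torus)) := (Lp.memLp h).comp_fst _
  refine MemLp.const_mul ?_ _
  refine MemLp.of_le h1 (h1.1.mul ((fourier n).continuous.comp
    continuous_snd).aestronglyMeasurable) ?_
  filter_upwards with p
  rw [norm_mul, fourier_apply, Circle.norm_coe, mul_one]

/-- The function `(x, y) ↦ (2π)^{-1/2} h(x) e^{iny}`. -/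
def planeWave (n : ℤ) (h : Lp ℂ 2 (volume : Measure ℝ)) : L2 ℂ := (memLp_mul_fourier h n).toLp

lemma hat_eq_of_yMode {u : L2 𝕜} {n : ℤ} {h : Lp ℂ 2 (volume : Measure ℝ)}
    (hu : ∀ᵐ x, yMode u n x = h x) : hat u n = 𝓕 h := by
  rw [hat]
  congr 1
  apply Lp.ext
  exact (memLp_yMode u n).coeFn_toLp.trans hu

lemma hat_planeWave (n k : ℤ) (h : Lp ℂ 2 (volume : Measure ℝ)) :
    hat (planeWave n h) k = if k = n then 𝓕 h else 0 := by
  have hy : ∀ᵐ x : ℝ, ∀ᵐ y : Torus, planeWave n h (x, y) =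
      ((Real.sqrt (2 * π))⁻¹ : ℂ) * (h x * fourier n y) :=
    Measure.ae_ae_of_ae_prod (memLp_mul_fourier h n).coeFn_toLp
  have hm : ∀ᵐ x, yMode (planeWave n h) k x = if k = n then h x else 0 := by
    filter_upwards [hy] with x hx
    rw [yMode, coefficient_congr hx, coefficient]
    have e : (fun y : Torus => (fourier (-k) y : ℂ) •
        RCLike.map ℂ ℂ (((Real.sqrt (2 * π))⁻¹ : ℂ) * (h x * fourier n y))) =
        fun y => (((Real.sqrt (2 * π))⁻¹ : ℂ) * h x) * (fourier (-k) y * fourier n y) := by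
      ext y
      rw [RCLike.map_same_eq_id]
      simp only [smul_eq_mul, ContinuousLinearMap.id_apply]
      ring
    rw [e, integral_const_mul, integral_fourier_mul_fourier]
    split_ifs
    · have h0 : Real.sqrt (2 * π) ≠ 0 := (Real.sqrt_pos.2 Real.two_pi_pos).ne'
      have h1 : ((Real.sqrt (2 * π) : ℝ) : ℂ) ≠ 0 := by exact_mod_cast h0
      have h2 : ((2 * π : ℝ) : ℂ) = (Real.sqrt (2 * π) : ℂ) ^ 2 := by
        rw [← Complex.ofReal_pow, Real.sq_sqrt Real.two_pi_pos.le]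
      rw [h2, Complex.real_smul, Complex.ofReal_inv]
      field_simp
    · simp
  split_ifs with hk
  · refine hat_eq_of_yMode ?_
    filter_upwards [hm] with x hx
    rw [hx, if_pos hk]
  · have : hat (planeWave n h) k = 𝓕 (0 : Lp ℂ 2 (volume : Measure ℝ)) := by
      refine hat_eq_of_yMode ?_
      filter_upwards [hm, Lp.coeFn_zero ℂ 2 (volume : Measure ℝ)] with x hx hx0
      rw [hx, if_neg hk, hx0]
      rfl
    rw [this]
    exact (Lp.fourierTransformₗᵢ ℝ ℂ).map_zero

/-- `planeWave n` as an isometry. -/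
def planeWaveₗᵢ (n : ℤ) : Lp ℂ 2 (volume : Measure ℝ) →ₗᵢ[ℂ] L2 ℂ where
  toFun := planeWave n
  map_add' g h := by
    refine hat_injective fun k => ?_
    rw [hat_add]
    simp only [hat_planeWave, FourierTransform.fourier_add]
    split_ifs <;> simp
  map_smul' a h := by
    refine hat_injective fun k => ?_
    rw [RingHom.id_apply, hat_smul]
    simp only [hat_planeWave, FourierTransform.fourier_smul, RCLike.map_same_eq_id]
    split_ifs <;> simp
  norm_map' h := by
    have h1 := hasSum_norm_sq_hat (planeWave n h)
    have h2 := hasSum_ite_eq n (‖h‖ ^ 2)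
    have e : (fun k => ‖hat (planeWave n h) k‖ ^ 2) = fun k => if k = n then ‖h‖ ^ 2 else 0 := by
      ext k
      rw [hat_planeWave]
      split_ifs <;> simp
    rw [e] at h1
    exact (sq_eq_sq₀ (norm_nonneg _) (norm_nonneg _)).1 (h1.unique h2)

lemma orthogonalFamily_planeWave :
    OrthogonalFamily ℂ (fun _ : ℤ => Lp ℂ 2 (volume : Measure ℝ)) planeWaveₗᵢ := by
  intro n k hnk g h
  have : inner ℂ (planeWave n g) (planeWave k h) = inner ℂ (0 : L2 ℂ) 0 := by
    refine inner_eq_of_hat fun j => ?_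
    filter_upwards [hat_zero_ae (𝕜 := ℂ) j] with η h1
    rw [h1, hat_planeWave, hat_planeWave]
    split_ifs with h3 h4
    · exact absurd (h4.symm.trans h3) hnk
    · simp
    · simp
    · simp
  rw [inner_zero_left] at this
  exact this

/-- Every square summable sequence of Fourier modes is attained. -/
lemma exists_hat_eq {F : ℤ → Lp ℂ 2 (volume : Measure ℝ)} (hF : Summable fun n => ‖F n‖ ^ 2) :
    ∃ u : L2 ℂ, ∀ n, hat u n = F n := by
  have hs : Summable fun n => planeWaveₗᵢ n (𝓕⁻ (F n)) := by
    rw [orthogonalFamily_planeWave.summable_iff_norm_sq_summable]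
    refine hF.congr fun n => ?_
    rw [← Lp.norm_fourier_eq (𝓕⁻ (F n)), FourierTransform.fourier_fourierInv_eq]
  refine ⟨∑' n, planeWaveₗᵢ n (𝓕⁻ (F n)), fun k => ?_⟩
  -- Taking the `k`-th mode is additive and continuous, so it passes through the infinite sum and
  -- picks out the single term `n = k`.
  let Φ : L2 ℂ →+ Lp ℂ 2 (volume : Measure ℝ) :=
    AddMonoidHom.mk' (fun u => hat u k) (fun u v => hat_add u v k)
  have hΦ : Continuous Φ := AddMonoidHomClass.continuous_of_bound Φ 1 fun u => by
    rw [one_mul]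
    exact norm_hat_le u k
  have h1 := hs.hasSum.map Φ hΦ
  have h2 : (Φ ∘ fun n => planeWaveₗᵢ n (𝓕⁻ (F n))) = fun n => if n = k then F k else 0 := by
    ext1 n
    change hat (planeWave n (𝓕⁻ (F n))) k = _
    rw [hat_planeWave, FourierTransform.fourier_fourierInv_eq]
    by_cases h : n = k
    · simp [h]
    · simp [h, Ne.symm h]
  rw [h2] at h1
  exact h1.unique (hasSum_ite_eq k (F k))

/-! ### Complexification and conjugation -/

/-- The complexification of an element of `L²(ℝ × 𝕋; 𝕜)`. -/
def toComplex (u : L2 𝕜) : L2 ℂ := (memLp_rclike_map (Lp.memLp u)).toLp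

lemma toComplex_ae (u : L2 𝕜) : ∀ᵐ p, toComplex u p = RCLike.map 𝕜 ℂ (u p) :=
  (memLp_rclike_map (Lp.memLp u)).coeFn_toLp

lemma hat_congr {𝕜' : Type*} [RCLike 𝕜'] {u : L2 𝕜} {v : L2 𝕜'}
    (h : ∀ᵐ p : ℝ × Torus, RCLike.map 𝕜 ℂ (u p) = RCLike.map 𝕜' ℂ (v p)) (n : ℤ) :
    hat u n = hat v n := by
  refine hat_eq_of_yMode ?_
  have h1 : ∀ᵐ x : ℝ, ∀ᵐ y : Torus, RCLike.map 𝕜 ℂ (u (x, y)) = RCLike.map 𝕜' ℂ (v (x, y)) :=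
    Measure.ae_ae_of_ae_prod h
  filter_upwards [h1, (memLp_yMode v n).coeFn_toLp] with x hx hv
  rw [hv, yMode, yMode, coefficient, coefficient]
  congr 1
  apply integral_congr_ae
  filter_upwards [hx] with y hy
  rw [hy]

lemma hat_toComplex (u : L2 𝕜) (n : ℤ) : hat (toComplex u) n = hat u n := by
  refine hat_congr ?_ n
  filter_upwards [toComplex_ae u] with p hp
  rw [hp, RCLike.map_same_eq_id]
  rfl

lemma coefficient_conj (f : Torus → ℂ) (n : ℤ) :
    coefficient (fun y => (starRingEnd ℂ) (f y)) n = (starRingEnd ℂ) (coefficient f (-n)) := by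
  rw [coefficient, coefficient, Complex.real_smul, Complex.real_smul, map_mul, Complex.conj_ofReal,
    ← integral_conj]
  congr 2
  ext y
  rw [RCLike.map_same_eq_id, neg_neg, fourier_neg]
  simp

lemma hat_conj {u v : L2 ℂ} (h : ∀ᵐ p : ℝ × Torus, v p = (starRingEnd ℂ) (u p)) (n : ℤ) :
    ∀ᵐ η : ℝ, hat v n η = (starRingEnd ℂ) (hat u (-n) (-η)) := by
  refine fourier_conj ?_
  have h1 : ∀ᵐ x : ℝ, ∀ᵐ y : Torus, v (x, y) = (starRingEnd ℂ) (u (x, y)) :=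
    Measure.ae_ae_of_ae_prod h
  filter_upwards [h1, (memLp_yMode v n).coeFn_toLp, (memLp_yMode u (-n)).coeFn_toLp] with x h1 h2 h3
  rw [h2, h3, yMode, coefficient_congr h1, coefficient_conj]
  rfl

/-! ### Fourier multipliers -/

/-- Bounded measurable symbols of multipliers that map real functions to real functions. -/
structure IsSymbol (m : ℤ → ℝ → ℂ) (B : ℝ) : Prop where
  measurable : ∀ n, Measurable (m n)
  bound : ∀ n η, ‖m n η‖ ≤ B
  symm : ∀ n η, (starRingEnd ℂ) (m (-n) (-η)) = m n η

lemma ae_neg {p : ℝ → Prop} (h : ∀ᵐ η : ℝ, p η) : ∀ᵐ η : ℝ, p (-η) :=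
  (Measure.measurePreserving_neg (volume : Measure ℝ)).quasiMeasurePreserving.ae h

lemma exists_hat_eq_mul_complex {m : ℤ → ℝ → ℂ} {B : ℝ} (hm : IsSymbol m B) (u : L2 ℂ) :
    ∃ v : L2 ℂ, ∀ n, ∀ᵐ η, hat v n η = m n η * hat u n η := by
  have hB : 0 ≤ B := (norm_nonneg _).trans (hm.bound 0 0)
  have hp (n : ℤ) : MemLp (fun η => m n η * hat u n η) 2 volume := by
    refine (Lp.memLp (hat u n)).of_le_mul (c := B)
      ((hm.measurable n).aestronglyMeasurable.mul (Lp.aestronglyMeasurable _)) ?_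
    filter_upwards with η
    rw [norm_mul]
    exact mul_le_mul_of_nonneg_right (hm.bound n η) (norm_nonneg _)
  obtain ⟨v, hv⟩ := exists_hat_eq (F := fun n => (hp n).toLp) (by
    refine Summable.of_nonneg_of_le (fun n => by positivity) (fun n => ?_)
      ((hasSum_norm_sq_hat u).summable.mul_left (B ^ 2))
    rw [← mul_pow]
    refine pow_le_pow_left₀ (norm_nonneg _) (Lp.norm_le_mul_norm_of_ae_le_mul ?_) 2
    filter_upwards [(hp n).coeFn_toLp] with η hη
    rw [hη, norm_mul]
    exact mul_le_mul_of_nonneg_right (hm.bound n η) (norm_nonneg _))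
  refine ⟨v, fun n => ?_⟩
  rw [hv]
  exact (hp n).coeFn_toLp

/-- The multiplier is built over `ℂ` and brought back to `𝕜`. For real scalars the symmetry
$\overline{m(-n,-\eta)}=m(n,\eta)$ is what makes the result real. -/
lemma exists_hat_eq_mul {m : ℤ → ℝ → ℂ} {B : ℝ} (hm : IsSymbol m B) (u : L2 𝕜) :
    ∃ v : L2 𝕜, ∀ n, ∀ᵐ η, hat v n η = m n η * hat u n η := by
  obtain ⟨w, hw⟩ := exists_hat_eq_mul_complex hm (toComplex u)
  have hv : MemLp (fun p : ℝ × Torus => RCLike.map ℂ 𝕜 (w p)) 2 volume :=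
    (RCLike.map ℂ 𝕜).comp_memLp' (Lp.memLp w)
  have key : ∀ᵐ p : ℝ × Torus, RCLike.map 𝕜 ℂ (RCLike.map ℂ 𝕜 (w p)) = w p := by
    -- Either `𝕜` is real, and `w` must be shown to equal its conjugate by comparing transforms, or
    -- `𝕜` is complex and nothing is lost in passing through `𝕜`.
    rcases RCLike.I_eq_zero_or_im_I_eq_one (K := 𝕜) with hI | hI
    · have hc : MemLp (fun p : ℝ × Torus => (starRingEnd ℂ) (w p)) 2 volume := (Lp.memLp w).star
      have e : hc.toLp = w := by
        refine hat_ae_injective fun n => ?_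
        have hu : ∀ᵐ p : ℝ × Torus, toComplex u p = (starRingEnd ℂ) (toComplex u p) := by
          filter_upwards [toComplex_ae u] with p hp
          rw [hp]
          simp [RCLike.im_eq_zero hI]
        filter_upwards [hat_conj hc.coeFn_toLp n, hw n, ae_neg (hw (-n)), hat_conj hu n]
          with η h1 h2 h3 h4
        rw [h1, h3, h2, map_mul, hm.symm, ← h4]
      have e2 := hc.coeFn_toLp
      rw [e] at e2
      filter_upwards [e2] with p hp
      have h1 := Complex.conj_eq_iff_real.1 hp.symm
      obtain ⟨r, hr⟩ := h1
      rw [hr]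
      simp
    · filter_upwards with p
      simp [hI]
  refine ⟨hv.toLp, fun n => ?_⟩
  rw [hat_congr (v := w) ?_ n, ← hat_toComplex u]
  · exact hw n
  · filter_upwards [hv.coeFn_toLp, key] with p h1 h2
    rw [h1, h2, RCLike.map_same_eq_id]
    rfl

variable (𝕜) in
/-- The Fourier multiplier with a given symbol. -/
def mult {m : ℤ → ℝ → ℂ} {B : ℝ} (hm : IsSymbol m B) : L2 𝕜 →L[𝕜] L2 𝕜 :=
  LinearMap.mkContinuous
    { toFun := fun u => (exists_hat_eq_mul hm u).choose
      map_add' := by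
        intro u v
        refine hat_ae_injective fun n => ?_
        filter_upwards [(exists_hat_eq_mul hm (u + v)).choose_spec n,
          (exists_hat_eq_mul hm u).choose_spec n, (exists_hat_eq_mul hm v).choose_spec n,
          hat_add_ae u v n, hat_add_ae (exists_hat_eq_mul hm u).choose
            (exists_hat_eq_mul hm v).choose n] with η h1 h2 h3 h4 h5
        rw [h1, h5, h2, h3, h4]
        ring
      map_smul' := by
        intro a u
        refine hat_ae_injective fun n => ?_
        filter_upwards [(exists_hat_eq_mul hm (a • u)).choose_spec n,
          (exists_hat_eq_mul hm u).choose_spec n, hat_smul_ae a u n,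
          hat_smul_ae a (exists_hat_eq_mul hm u).choose n] with η h1 h2 h3 h4
        rw [RingHom.id_apply, h1, h4, h2, h3]
        ring }
    B (by
      intro u
      refine norm_le_of_hat (fun n => ?_) ((norm_nonneg _).trans (hm.bound 0 0))
      filter_upwards [(exists_hat_eq_mul hm u).choose_spec n] with η h1
      change ‖hat (exists_hat_eq_mul hm u).choose n η‖ ≤ _
      rw [h1, norm_mul]
      exact mul_le_mul_of_nonneg_right (hm.bound n η) (norm_nonneg _))

lemma hat_mult {m : ℤ → ℝ → ℂ} {B : ℝ} (hm : IsSymbol m B) (u : L2 𝕜) (n : ℤ) :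
    ∀ᵐ η, hat (mult 𝕜 hm u) n η = m n η * hat u n η :=
  (exists_hat_eq_mul hm u).choose_spec n

/-! ### Modes and weak derivatives -/

lemma yMode_eq_of_hat {u v : L2 𝕜} {n : ℤ} (h : hat u n = hat v n) :
    ∀ᵐ x, yMode u n x = yMode v n x := by
  have h1 := (Lp.fourierTransformₗᵢ ℝ ℂ).injective h
  filter_upwards [(memLp_yMode u n).coeFn_toLp, (memLp_yMode v n).coeFn_toLp] with x h2 h3
  rw [← h2, ← h3, h1]

lemma hat_eq_of_yMode_eq {u v : L2 𝕜} {n : ℤ} (h : ∀ᵐ x, yMode u n x = yMode v n x) :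
    hat u n = hat v n := by
  refine hat_eq_of_yMode ?_
  filter_upwards [h, (memLp_yMode v n).coeFn_toLp] with x h1 h2
  rw [h1, h2]

lemma isDx_iff (u v : L2 𝕜) :
    IsDx u v ↔ ∀ n, IsWeakDeriv (memLp_yMode u n).toLp (memLp_yMode v n).toLp :=
  forall_congr' fun n => fourier_eq_mul_iff (memLp_yMode u n).toLp (memLp_yMode v n).toLp

lemma yMode_add (u v : L2 𝕜) (n : ℤ) :
    ∀ᵐ x, yMode (u + v) n x = yMode u n x + yMode v n x := by
  have h : ∀ᵐ x : ℝ, ∀ᵐ y : Torus, (u + v : L2 𝕜) (x, y) = u (x, y) + v (x, y) :=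
    Measure.ae_ae_of_ae_prod (Lp.coeFn_add u v)
  filter_upwards [h, memLp_fibre u, memLp_fibre v] with x hx hu hv
  simp only [yMode]
  rw [coefficient_congr hx, coefficient_add hu hv]

lemma yMode_smul (a : 𝕜) (u : L2 𝕜) (n : ℤ) :
    ∀ᵐ x, yMode (a • u) n x = RCLike.map 𝕜 ℂ a * yMode u n x := by
  have h : ∀ᵐ x : ℝ, ∀ᵐ y : Torus, (a • u : L2 𝕜) (x, y) = a * u (x, y) :=
    Measure.ae_ae_of_ae_prod (Lp.coeFn_smul a u)
  filter_upwards [h] with x hx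
  simp only [yMode]
  rw [coefficient_congr hx, coefficient_smul]

/-! ### Multiplication by the kink -/

lemma mulKink_ae (c : ℝ) (u : L2 𝕜) :
    ∀ᵐ p : ℝ × Torus, mulKink 𝕜 c u p = (kink c p.1 : 𝕜) * u p :=
  (memLp_kink_mul c u).coeFn_toLp

lemma yMode_mulKink (c : ℝ) (u : L2 𝕜) (n : ℤ) :
    ∀ᵐ x, yMode (mulKink 𝕜 c u) n x = kink c x * yMode u n x := by
  have h : ∀ᵐ x : ℝ, ∀ᵐ y : Torus, mulKink 𝕜 c u (x, y) = (kink c x : 𝕜) * u (x, y) :=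
    Measure.ae_ae_of_ae_prod (mulKink_ae c u)
  filter_upwards [h] with x hx
  simp only [yMode]
  rw [coefficient_congr hx, coefficient_smul]
  simp

lemma inner_mulKink (c : ℝ) (u v : L2 𝕜) :
    inner 𝕜 (mulKink 𝕜 c u) v = inner 𝕜 u (mulKink 𝕜 c v) := by
  rw [MeasureTheory.L2.inner_def, MeasureTheory.L2.inner_def]
  apply integral_congr_ae
  filter_upwards [mulKink_ae c u, mulKink_ae c v] with p h1 h2
  rw [h1, h2]
  simp only [RCLike.inner_apply, map_mul, RCLike.conj_ofReal]
  ring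

lemma norm_mulKink_le (c : ℝ) (u : L2 𝕜) : ‖mulKink 𝕜 c u‖ ≤ Real.sqrt (c / 2) * ‖u‖ := by
  refine Lp.norm_le_mul_norm_of_ae_le_mul ?_
  filter_upwards [mulKink_ae c u] with p hp
  rw [hp, norm_mul, RCLike.norm_ofReal]
  exact mul_le_mul_of_nonneg_right (abs_kink_le c p.1) (norm_nonneg _)

lemma rclike_map_ofReal (r : ℝ) : RCLike.map 𝕜 ℂ (r : 𝕜) = r := by
  simp

/-- The product rule `∂ₓ(Q u) = Q ∂ₓu + (c/2 - Q²) u`. -/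
lemma IsDx.mulKink {c : ℝ} (hc : 0 ≤ c) {u v : L2 𝕜} (h : IsDx u v) :
    IsDx (mulKink 𝕜 c u)
      (mulKink 𝕜 c v + (((c / 2 : ℝ) : 𝕜) • u + (-1 : 𝕜) • mulKink 𝕜 c (mulKink 𝕜 c u))) := by
  rw [isDx_iff] at h ⊢
  intro n
  refine (h n).kink_mul hc ?_ ?_
  · filter_upwards [(memLp_yMode (KPII.mulKink 𝕜 c u) n).coeFn_toLp,
      (memLp_yMode u n).coeFn_toLp, yMode_mulKink c u n] with x h1 h2 h3
    rw [h1, h2, h3]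
  · filter_upwards [(memLp_yMode (KPII.mulKink 𝕜 c v + (((c / 2 : ℝ) : 𝕜) • u +
        (-1 : 𝕜) • KPII.mulKink 𝕜 c (KPII.mulKink 𝕜 c u))) n).coeFn_toLp,
      (memLp_yMode u n).coeFn_toLp, (memLp_yMode v n).coeFn_toLp, yMode_mulKink c v n,
      yMode_mulKink c u n, yMode_mulKink c (KPII.mulKink 𝕜 c u) n,
      yMode_add (KPII.mulKink 𝕜 c v) (((c / 2 : ℝ) : 𝕜) • u +
        (-1 : 𝕜) • KPII.mulKink 𝕜 c (KPII.mulKink 𝕜 c u)) n,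
      yMode_add (((c / 2 : ℝ) : 𝕜) • u) ((-1 : 𝕜) • KPII.mulKink 𝕜 c (KPII.mulKink 𝕜 c u)) n,
      yMode_smul ((c / 2 : ℝ) : 𝕜) u n,
      yMode_smul (-1 : 𝕜) (KPII.mulKink 𝕜 c (KPII.mulKink 𝕜 c u)) n]
      with x h1 h2 h3 h4 h5 h6 h7 h8 h9 h10
    rw [h1, h2, h3, h7, h8, h9, h10, h4, h6, h5, rclike_map_ofReal]
    simp
    ring

/-! ### Symmetries of the multipliers -/

lemma inner_isDx {u u' v v' : L2 𝕜} (hu : IsDx u u') (hv : IsDx v v') :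
    inner 𝕜 u' v = -inner 𝕜 u v' := by
  rw [← inner_neg_right, ← neg_one_smul 𝕜]
  refine inner_eq_of_hat fun n => ?_
  filter_upwards [hu n, hv n, hat_smul_ae (-1 : 𝕜) v' n] with η h1 h2 h3
  rw [h3, h1, h2]
  simp [map_ofNat]
  ring

/-- The symbol $n/\xi$ is real, so the multiplier is symmetric, whereas $i\xi$ made $\partial_x$
skew. -/
lemma inner_isDxInvDy {u u' v v' : L2 𝕜} (hu : IsDxInvDy u u') (hv : IsDxInvDy v v') :
    inner 𝕜 u' v = inner 𝕜 u v' := by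
  refine inner_eq_of_hat fun n => ?_
  filter_upwards [hu n, hv n] with η h1 h2
  rw [h1, h2]
  simp [map_ofNat]
  ring

/-- The integration by parts `2 Re(Q u, ∂ₓu) = -((c/2 - Q²) u, u)`. -/
lemma re_inner_mulKink_isDx {c : ℝ} (hc : 0 ≤ c) {u v : L2 𝕜} (h : IsDx u v) :
    2 * RCLike.re (inner 𝕜 (mulKink 𝕜 c u) v) = ‖mulKink 𝕜 c u‖ ^ 2 - c / 2 * ‖u‖ ^ 2 := by
  have h1 := congrArg RCLike.re (inner_isDx (h.mulKink hc) h)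
  simp only [inner_add_left, inner_smul_left, map_add, map_neg, map_one, RCLike.conj_ofReal,
    RCLike.re_ofReal_mul, neg_mul, one_mul] at h1
  rw [inner_mulKink c v, inner_re_symm v, inner_mulKink c (mulKink 𝕜 c u),
    inner_self_eq_norm_sq, inner_self_eq_norm_sq] at h1
  linarith

lemma norm_sq_mulKink_le {c : ℝ} (hc : 0 ≤ c) (u : L2 𝕜) :
    ‖mulKink 𝕜 c u‖ ^ 2 ≤ c / 2 * ‖u‖ ^ 2 := by
  have h := pow_le_pow_left₀ (norm_nonneg _) (norm_mulKink_le c u) 2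
  rwa [mul_pow, Real.sq_sqrt (by positivity)] at h

/-! ### The mean in `y` -/

lemma isSymbol_mean : IsSymbol (fun n _ => if n = 0 then 1 else 0) 1 where
  measurable n := measurable_const
  bound n η := by split_ifs <;> simp
  symm n η := by
    simp only [neg_eq_zero]
    split_ifs <;> simp

variable (𝕜) in
/-- The mean in `y`: the projection to the zero mode. -/
def mean : L2 𝕜 →L[𝕜] L2 𝕜 := mult 𝕜 isSymbol_mean

lemma hat_mean (u : L2 𝕜) (n : ℤ) : ∀ᵐ η, hat (mean 𝕜 u) n η = if n = 0 then hat u n η else 0 := by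
  filter_upwards [hat_mult (𝕜 := 𝕜) isSymbol_mean u n] with η h
  rw [mean, h]
  split_ifs <;> simp

lemma hat_mean_zero (u : L2 𝕜) : hat (mean 𝕜 u) 0 = hat u 0 := by
  refine Lp.ext ?_
  filter_upwards [hat_mean u 0] with η h
  rw [h, if_pos rfl]

lemma hat_mean_of_ne (u : L2 𝕜) {n : ℤ} (hn : n ≠ 0) : hat (mean 𝕜 u) n = 0 := by
  refine Lp.ext ?_
  filter_upwards [hat_mean u n, Lp.coeFn_zero ℂ 2 (volume : Measure ℝ)] with η h h0
  rw [h, if_neg hn, h0]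
  rfl

lemma mean_mean (u : L2 𝕜) : mean 𝕜 (mean 𝕜 u) = mean 𝕜 u := by
  refine hat_injective fun n => ?_
  rcases eq_or_ne n 0 with rfl | hn
  · rw [hat_mean_zero]
  · rw [hat_mean_of_ne _ hn, hat_mean_of_ne _ hn]

lemma inner_mean (u v : L2 𝕜) : inner 𝕜 (mean 𝕜 u) v = inner 𝕜 u (mean 𝕜 v) := by
  refine inner_eq_of_hat fun n => ?_
  filter_upwards [hat_mean u n, hat_mean v n] with η h1 h2
  rw [h1, h2]
  split_ifs <;> simp

lemma inner_mean_sub_mean (u v : L2 𝕜) : inner 𝕜 (mean 𝕜 u) (v - mean 𝕜 v) = 0 := by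
  rw [inner_mean, map_sub, mean_mean, sub_self, inner_zero_right]

lemma norm_sq_eq_mean (u : L2 𝕜) : ‖u‖ ^ 2 = ‖mean 𝕜 u‖ ^ 2 + ‖u - mean 𝕜 u‖ ^ 2 := by
  have h := norm_add_sq_eq_norm_sq_add_norm_sq_of_inner_eq_zero _ _ (inner_mean_sub_mean u u)
  rw [add_sub_cancel] at h
  simpa only [← sq] using h

lemma norm_sub_mean_le (u : L2 𝕜) : ‖u - mean 𝕜 u‖ ≤ ‖u‖ := by
  rw [← sq_le_sq₀ (norm_nonneg _) (norm_nonneg _), norm_sq_eq_mean u]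
  exact le_add_of_nonneg_left (by positivity)

lemma norm_mean_le (u : L2 𝕜) : ‖mean 𝕜 u‖ ≤ ‖u‖ := by
  rw [← sq_le_sq₀ (norm_nonneg _) (norm_nonneg _), norm_sq_eq_mean u]
  exact le_add_of_nonneg_right (by positivity)

lemma yMode_zero_ae (n : ℤ) : ∀ᵐ x, yMode (0 : L2 𝕜) n x = 0 := by
  simpa using yMode_smul (0 : 𝕜) (0 : L2 𝕜) n

lemma hat_zero (n : ℤ) : hat (0 : L2 𝕜) n = 0 := by
  simpa using hat_smul (0 : 𝕜) (0 : L2 𝕜) n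

/-- The kink does not depend on $y$, so multiplication by it acts on each mode separately. -/
lemma mean_mulKink (c : ℝ) (u : L2 𝕜) : mean 𝕜 (mulKink 𝕜 c u) = mulKink 𝕜 c (mean 𝕜 u) := by
  refine hat_injective fun n => ?_
  rcases eq_or_ne n 0 with rfl | hn
  · rw [hat_mean_zero]
    refine hat_eq_of_yMode_eq ?_
    filter_upwards [yMode_mulKink c u 0, yMode_mulKink c (mean 𝕜 u) 0,
      yMode_eq_of_hat (hat_mean_zero u)] with x h1 h2 h3
    rw [h1, h2, h3]
  · rw [hat_mean_of_ne _ hn, ← hat_zero (𝕜 := 𝕜)]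
    refine hat_eq_of_yMode_eq ?_
    filter_upwards [yMode_mulKink c (mean 𝕜 u) n, yMode_zero_ae (𝕜 := 𝕜) n,
      yMode_eq_of_hat ((hat_mean_of_ne u hn).trans (hat_zero (𝕜 := 𝕜) n).symm)] with x h1 h2 h3
    rw [h1, h2, h3, h2, mul_zero]

lemma IsDx.mean {u v : L2 𝕜} (h : IsDx u v) : IsDx (mean 𝕜 u) (mean 𝕜 v) := by
  intro n
  filter_upwards [hat_mean u n, hat_mean v n, h n] with η h1 h2 h3
  rw [h1, h2, h3]
  split_ifs <;> simp

lemma IsDxInvDy.mean_eq_zero {u v : L2 𝕜} (h : IsDxInvDy u v) : mean 𝕜 v = 0 := by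
  refine hat_ae_injective fun n => ?_
  filter_upwards [hat_mean v n, hat_zero_ae (𝕜 := 𝕜) n, h n] with η h1 h2 h3
  rw [h1, h2, h3]
  split_ifs with hn <;> simp [hn]

lemma IsDxInvDy.mean {u v : L2 𝕜} (h : IsDxInvDy u v) : IsDxInvDy (mean 𝕜 u) (mean 𝕜 v) := by
  intro n
  filter_upwards [hat_mean u n, hat_mean v n, h n] with η h1 h2 h3
  rw [h1, h2, h3]
  split_ifs <;> simp

/-! ### Elements of the energy space -/

/-- The element of `𝓔` with given components. -/
def mkE {u v w : L2 𝕜} (h1 : IsDx u v) (h2 : IsDxInvDy u w) : E 𝕜 :=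
  ⟨WithLp.toLp 2 ![u, v, w], h1, h2⟩

@[simp] lemma incl_mkE {u v w : L2 𝕜} (h1 : IsDx u v) (h2 : IsDxInvDy u w) :
    incl 𝕜 (mkE h1 h2) = u := rfl

@[simp] lemma dx_mkE {u v w : L2 𝕜} (h1 : IsDx u v) (h2 : IsDxInvDy u w) :
    dx 𝕜 (mkE h1 h2) = v := rfl

@[simp] lemma dxInvDy_mkE {u v w : L2 𝕜} (h1 : IsDx u v) (h2 : IsDxInvDy u w) :
    dxInvDy 𝕜 (mkE h1 h2) = w := rfl

lemma isDx_dx (w : E 𝕜) : IsDx (incl 𝕜 w) (dx 𝕜 w) := w.2.1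

lemma isDxInvDy_dxInvDy (w : E 𝕜) : IsDxInvDy (incl 𝕜 w) (dxInvDy 𝕜 w) := w.2.2

/-- The zero mode of an element of `𝓔`. -/
def meanE (w : E 𝕜) : E 𝕜 := mkE (isDx_dx w).mean (isDxInvDy_dxInvDy w).mean

lemma mean_dxInvDy (w : E 𝕜) : mean 𝕜 (dxInvDy 𝕜 w) = 0 := (isDxInvDy_dxInvDy w).mean_eq_zero

/-! ### The symbol `±iξ + n/ξ + 1_{n = 0}` -/

/-- The symbol `s iξ + n/ξ + 1_{n = 0}`, where `ξ = 2πη`. -/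
def sigma (s : ℝ) (n : ℤ) (η : ℝ) : ℂ :=
  s * (Complex.I * (2 * π * η)) + (Complex.I * (2 * π * η))⁻¹ * (Complex.I * n) +
    if n = 0 then 1 else 0

lemma sigma_eq (s : ℝ) (n : ℤ) (η : ℝ) :
    sigma s n η = ⟨n / (2 * π * η) + if n = 0 then 1 else 0, s * (2 * π * η)⟩ := by
  have h : (Complex.I * (2 * π * η))⁻¹ * (Complex.I * n) = ((n / (2 * π * η) : ℝ) : ℂ) := by
    push_cast
    rw [mul_inv, mul_comm Complex.I⁻¹, mul_assoc, ← mul_assoc Complex.I⁻¹,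
      inv_mul_cancel₀ Complex.I_ne_zero, one_mul, div_eq_mul_inv, mul_comm]
  have h2 : (s : ℂ) * (Complex.I * (2 * π * η)) = ((s * (2 * π * η) : ℝ) : ℂ) * Complex.I := by
    push_cast
    ring
  rw [sigma, h, h2]
  apply Complex.ext
  · split_ifs <;> simp [-Complex.ofReal_div]
  · split_ifs <;> simp [-Complex.ofReal_div]

/-- For $s=\pm1$ the part $s\,i\xi$ is imaginary and $n/\xi+1_{n=0}$ is real, so no cancellation
occurs; at $n=0$ the cross term vanishes because $n/\xi=0$. -/
lemma normSq_sigma {s : ℝ} (hs : s ^ 2 = 1) (n : ℤ) (η : ℝ) :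
    ‖sigma s n η‖ ^ 2 = (2 * π * η) ^ 2 + (n / (2 * π * η)) ^ 2 + if n = 0 then 1 else 0 := by
  rw [sigma_eq, Complex.sq_norm, Complex.normSq_apply]
  split_ifs with hn
  · simp only [hn, Int.cast_zero, zero_div]
    linear_combination (2 * π * η) ^ 2 * hs
  · linear_combination (2 * π * η) ^ 2 * hs

/-- For $n\ne0$ this is $\xi^2+(n/\xi)^2\ge2|n|$; for $n=0$ the added mean supplies the $1$. At
$\eta=0$ the convention $0^{-1}=0$ makes the symbol vanish when $n\ne0$, hence the exclusion. -/
lemma one_le_norm_sigma {s : ℝ} (hs : s ^ 2 = 1) (n : ℤ) {η : ℝ} (hη : η ≠ 0) :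
    1 ≤ ‖sigma s n η‖ := by
  rw [← one_le_sq_iff₀ (norm_nonneg _), normSq_sigma hs]
  split_ifs with hn
  · exact le_add_of_nonneg_left (by positivity)
  · set ξ := 2 * π * η with hξ
    have h0 : ξ ≠ 0 := mul_ne_zero Real.two_pi_pos.ne' hη
    have h1 : ξ * (n / ξ) = n := by field_simp
    have h2 : (1 : ℝ) ≤ |(n : ℝ)| := by exact_mod_cast Int.one_le_abs hn
    rw [← h1, abs_mul] at h2
    nlinarith [sq_abs ξ, sq_abs (n / ξ), sq_nonneg (|ξ| - |n / ξ|)]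

lemma norm_xi_le_sigma {s : ℝ} (hs : s ^ 2 = 1) (n : ℤ) (η : ℝ) :
    ‖Complex.I * (2 * π * η)‖ ≤ ‖sigma s n η‖ := by
  rw [← sq_le_sq₀ (norm_nonneg _) (norm_nonneg _), normSq_sigma hs]
  have h : ‖Complex.I * (2 * π * η)‖ ^ 2 = (2 * π * η) ^ 2 := by
    simp [mul_pow, sq_abs]
  rw [h, add_assoc]
  refine le_add_of_nonneg_right (add_nonneg (by positivity) ?_)
  split_ifs <;> simp

lemma norm_xi_inv_le_sigma {s : ℝ} (hs : s ^ 2 = 1) (n : ℤ) (η : ℝ) :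
    ‖(Complex.I * (2 * π * η))⁻¹ * (Complex.I * n)‖ ≤ ‖sigma s n η‖ := by
  rw [← sq_le_sq₀ (norm_nonneg _) (norm_nonneg _), normSq_sigma hs]
  have h : ‖(Complex.I * (2 * π * η))⁻¹ * (Complex.I * n)‖ ^ 2 = (n / (2 * π * η)) ^ 2 := by
    simp [mul_pow, div_pow, sq_abs]
    ring
  rw [h, add_right_comm]
  refine le_add_of_nonneg_left (add_nonneg (by positivity) ?_)
  split_ifs <;> simp

lemma measurable_sigma (s : ℝ) (n : ℤ) : Measurable (sigma s n) := by
  unfold sigma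
  fun_prop

lemma conj_sigma (s : ℝ) (n : ℤ) (η : ℝ) :
    (starRingEnd ℂ) (sigma s (-n) (-η)) = sigma s n η := by
  simp only [sigma, map_add, map_mul, map_inv₀, Complex.conj_I, Complex.conj_ofReal, map_ofNat,
    Int.cast_neg, Complex.ofReal_neg, map_neg, map_intCast, neg_eq_zero]
  congr 1
  · ring
  · split_ifs <;> simp

/-- Quotients of symbols by `sigma`, set to zero at the frequency `0`. -/
lemma isSymbol_div_sigma {s : ℝ} {m : ℤ → ℝ → ℂ} (hm : ∀ n, Measurable (m n))
    (hle : ∀ n, ∀ η : ℝ, η ≠ 0 → ‖m n η‖ ≤ ‖sigma s n η‖)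
    (hsymm : ∀ n η, (starRingEnd ℂ) (m (-n) (-η)) = m n η) :
    IsSymbol (fun n η => if η = 0 then 0 else m n η / sigma s n η) 1 where
  measurable n :=
    Measurable.ite (measurableSet_singleton 0) measurable_const ((hm n).div (measurable_sigma s n))
  bound n η := by
    split_ifs with h
    · simp
    · rw [norm_div]
      exact div_le_one_of_le₀ (hle n η h) (norm_nonneg _)
  symm n η := by
    simp only [neg_eq_zero]
    split_ifs
    · simp
    · rw [map_div₀, hsymm, conj_sigma]

lemma ae_ne_zero : ∀ᵐ η : ℝ, η ≠ 0 := by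
  simp [ae_iff]

/-- `s ∂ₓ + ∂ₓ⁻¹∂_y + P` is onto for `s = ±1`, where `P` is the mean in `y`. -/
lemma exists_isDx_add_isDxInvDy {s : ℝ} (hs : s ^ 2 = 1) (f : L2 𝕜) :
    ∃ w : E 𝕜, (s : 𝕜) • dx 𝕜 w + dxInvDy 𝕜 w + mean 𝕜 (incl 𝕜 w) = f := by
  have hs1 := isSymbol_div_sigma (s := s) (m := fun _ _ => 1) (fun _ => measurable_const)
    (fun n η hη => by simpa using one_le_norm_sigma hs n hη) (by simp)
  have hs2 := isSymbol_div_sigma (s := s) (m := fun _ η => Complex.I * (2 * π * η))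
    (fun _ => by fun_prop) (fun n η _ => norm_xi_le_sigma hs n η) (fun n η => by simp [map_ofNat])
  have hs3 := isSymbol_div_sigma (s := s)
    (m := fun n η => (Complex.I * (2 * π * η))⁻¹ * (Complex.I * n))
    (fun _ => by fun_prop) (fun n η _ => norm_xi_inv_le_sigma hs n η)
    (fun n η => by simp [map_ofNat])
  have h1 : IsDx (mult 𝕜 hs1 f) (mult 𝕜 hs2 f) := by
    intro n
    filter_upwards [hat_mult hs1 f n, hat_mult hs2 f n] with η h1 h2
    rw [h1, h2]
    split_ifs
    · simp
    · ring
  have h2 : IsDxInvDy (mult 𝕜 hs1 f) (mult 𝕜 hs3 f) := by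
    intro n
    filter_upwards [hat_mult hs1 f n, hat_mult hs3 f n] with η h1 h2
    rw [h1, h2]
    split_ifs
    · simp
    · ring
  refine ⟨mkE h1 h2, ?_⟩
  rw [incl_mkE, dx_mkE, dxInvDy_mkE]
  refine hat_ae_injective fun n => ?_
  filter_upwards [hat_add_ae ((s : 𝕜) • mult 𝕜 hs2 f + mult 𝕜 hs3 f) (mean 𝕜 (mult 𝕜 hs1 f)) n,
    hat_add_ae ((s : 𝕜) • mult 𝕜 hs2 f) (mult 𝕜 hs3 f) n, hat_smul_ae (s : 𝕜) (mult 𝕜 hs2 f) n,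
    hat_mean (mult 𝕜 hs1 f) n, hat_mult hs1 f n, hat_mult hs2 f n, hat_mult hs3 f n, ae_ne_zero]
    with η e1 e2 e3 e4 e5 e6 e7 hη
  rw [e1, e2, e3, e4, e5, e6, e7, if_neg hη, if_neg hη, if_neg hη, rclike_map_ofReal]
  have h0 : sigma s n η ≠ 0 := by
    have := one_le_norm_sigma hs n hη
    intro h
    rw [h, norm_zero] at this
    linarith
  have h3 : sigma s n η / sigma s n η = 1 := div_self h0
  have h4 : (if n = 0 then 1 / sigma s n η * hat f n η else 0) =
      (if n = 0 then 1 else 0) * (1 / sigma s n η * hat f n η) := by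
    split_ifs <;> simp
  have h5 := sigma.eq_1 s n η
  rw [h4]
  set d := sigma s n η
  linear_combination (hat f n η) * h3 - (hat f n η / d) * h5

/-- `‖w‖_𝓔 ≤ 2 ‖(s ∂ₓ + ∂ₓ⁻¹∂_y + P) w‖` for `s = ±1`. -/
lemma norm_E_le {s : ℝ} (hs : s ^ 2 = 1) (w : E 𝕜) :
    ‖w‖ ≤ 2 * ‖(s : 𝕜) • dx 𝕜 w + dxInvDy 𝕜 w + mean 𝕜 (incl 𝕜 w)‖ := by
  set f := (s : 𝕜) • dx 𝕜 w + dxInvDy 𝕜 w + mean 𝕜 (incl 𝕜 w) with hf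
  have hh (n : ℤ) : ∀ᵐ η, hat f n η = sigma s n η * hat (incl 𝕜 w) n η := by
    filter_upwards [hat_add_ae ((s : 𝕜) • dx 𝕜 w + dxInvDy 𝕜 w) (mean 𝕜 (incl 𝕜 w)) n,
      hat_add_ae ((s : 𝕜) • dx 𝕜 w) (dxInvDy 𝕜 w) n, hat_smul_ae (s : 𝕜) (dx 𝕜 w) n,
      hat_mean (incl 𝕜 w) n, isDx_dx w n, isDxInvDy_dxInvDy w n] with η e1 e2 e3 e4 e5 e6
    rw [hf, e1, e2, e3, e4, e5, e6, rclike_map_ofReal, sigma]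
    split_ifs <;> ring
  have n1 : ‖incl 𝕜 w‖ ≤ 1 * ‖f‖ := by
    refine norm_le_of_hat (fun n => ?_) zero_le_one
    filter_upwards [hh n, ae_ne_zero] with η h hη
    rw [h, norm_mul, one_mul]
    exact le_mul_of_one_le_left (norm_nonneg _) (one_le_norm_sigma hs n hη)
  have n2 : ‖dx 𝕜 w‖ ≤ 1 * ‖f‖ := by
    refine norm_le_of_hat (fun n => ?_) zero_le_one
    filter_upwards [hh n, isDx_dx w n] with η h h2
    rw [h, h2, one_mul, norm_mul _ (hat (incl 𝕜 w) n η), norm_mul _ (hat (incl 𝕜 w) n η)]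
    exact mul_le_mul_of_nonneg_right (norm_xi_le_sigma hs n η) (norm_nonneg _)
  have n3 : ‖dxInvDy 𝕜 w‖ ≤ 1 * ‖f‖ := by
    refine norm_le_of_hat (fun n => ?_) zero_le_one
    filter_upwards [hh n, isDxInvDy_dxInvDy w n] with η h h2
    rw [h, h2, ← mul_assoc, one_mul, norm_mul _ (hat (incl 𝕜 w) n η),
      norm_mul _ (hat (incl 𝕜 w) n η)]
    exact mul_le_mul_of_nonneg_right (norm_xi_inv_le_sigma hs n η) (norm_nonneg _)
  rw [one_mul] at n1 n2 n3
  -- Each of the three components is at most $\|f\|$, and $3\le2^2$.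
  rw [← sq_le_sq₀ (norm_nonneg _) (by positivity), norm_sq_E, mul_pow]
  have m1 := pow_le_pow_left₀ (norm_nonneg _) n1 2
  have m2 := pow_le_pow_left₀ (norm_nonneg _) n2 2
  have m3 := pow_le_pow_left₀ (norm_nonneg _) n3 2
  nlinarith [sq_nonneg ‖f‖]

/-! ### The antiderivative in `x` of the nonzero modes -/

lemma isSymbol_inv : IsSymbol (fun n _ => (Complex.I * n)⁻¹) 1 where
  measurable n := measurable_const
  bound n η := by
    rw [norm_inv, norm_mul, Complex.norm_I, one_mul, Complex.norm_intCast]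
    rcases eq_or_ne n 0 with rfl | hn
    · simp
    · exact inv_le_one_of_one_le₀ (by exact_mod_cast Int.one_le_abs hn)
  symm n η := by simp

/-- The nonzero modes of an element of `𝓔` have an antiderivative `g` in `L²` with
`Re (∂ₓ⁻¹∂_y w, g) = 0`. -/
lemma exists_antideriv (w : E 𝕜) : ∃ g : L2 𝕜, IsDx g (incl 𝕜 w - mean 𝕜 (incl 𝕜 w)) ∧
    mean 𝕜 g = 0 ∧ ‖g‖ ≤ ‖dxInvDy 𝕜 w‖ ∧ RCLike.re (inner 𝕜 g (dxInvDy 𝕜 w)) = 0 := by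
  -- Dividing $(in/(i\xi))\hat w$ by $in$ leaves $\hat w/(i\xi)$ for $n\ne0$ and $0$ for $n=0$. The
  -- divisor has modulus at least $1$, which bounds $g$, and is imaginary, which makes the last real
  -- part vanish.
  refine ⟨mult 𝕜 isSymbol_inv (dxInvDy 𝕜 w), fun n => ?_, ?_, ?_, ?_⟩
  · filter_upwards [hat_mult isSymbol_inv (dxInvDy 𝕜 w) n, isDxInvDy_dxInvDy w n,
      hat_add_ae (incl 𝕜 w) ((-1 : 𝕜) • mean 𝕜 (incl 𝕜 w)) n,
      hat_smul_ae (-1 : 𝕜) (mean 𝕜 (incl 𝕜 w)) n, hat_mean (incl 𝕜 w) n, ae_ne_zero]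
      with η h1 h2 h3 h4 h5 hη
    rw [neg_one_smul, ← sub_eq_add_neg] at h3
    rw [neg_one_smul] at h4
    rw [h3, h4, h5, h1, h2]
    split_ifs with hn
    · simp [hn]
    · have h6 : (Complex.I * (2 * π * η)) ≠ 0 := by
        simp [Complex.I_ne_zero, hη, Real.pi_ne_zero]
      have h7 : Complex.I * (n : ℂ) ≠ 0 := by simp [hn]
      rw [mul_zero, add_zero, mul_left_comm, mul_inv_cancel_left₀ h6, inv_mul_cancel_left₀ h7]
  · refine hat_ae_injective fun n => ?_
    filter_upwards [hat_mean (mult 𝕜 isSymbol_inv (dxInvDy 𝕜 w)) n,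
      hat_mult isSymbol_inv (dxInvDy 𝕜 w) n, hat_zero_ae (𝕜 := 𝕜) n] with η h1 h2 h3
    rw [h1, h3, h2]
    split_ifs with hn
    · simp [hn]
    · rfl
  · rw [← one_mul ‖dxInvDy 𝕜 w‖]
    refine norm_le_of_hat (fun n => ?_) zero_le_one
    filter_upwards [hat_mult isSymbol_inv (dxInvDy 𝕜 w) n] with η h1
    rw [h1, norm_mul]
    exact mul_le_mul_of_nonneg_right (isSymbol_inv.bound n η) (norm_nonneg _)
  · have : RCLike.re (inner 𝕜 (mult 𝕜 isSymbol_inv (dxInvDy 𝕜 w)) (dxInvDy 𝕜 w)) =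
        RCLike.re (inner 𝕜 (0 : L2 𝕜) 0) := by
      refine re_inner_eq_of_hat fun n => ?_
      filter_upwards [hat_mult isSymbol_inv (dxInvDy 𝕜 w) n, hat_zero_ae (𝕜 := 𝕜) n] with η h1 h2
      rw [h1, h2, map_mul, mul_left_comm, Complex.mul_conj]
      simp
    rw [this, inner_zero_left, map_zero]

/-! ### The method of continuity -/

section Continuity

variable {X Y : Type*} [NormedAddCommGroup X] [NormedSpace 𝕜 X]
  [NormedAddCommGroup Y] [NormedSpace 𝕜 Y] [CompleteSpace Y]

/-- With $R=T^{-1}$, $SR=1+(S-T)R$ is invertible by the Neumann series. -/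
lemma surjective_of_norm_sub_lt {T S : X →L[𝕜] Y} {C : ℝ} (hC : ∀ x, ‖x‖ ≤ C * ‖T x‖)
    (hT : Function.Surjective T) (hC0 : 0 ≤ C) (h : ‖S - T‖ * C < 1) :
    Function.Surjective S := by
  have hinj : Function.Injective T := by
    rw [injective_iff_map_eq_zero]
    intro x hx
    have := hC x
    rw [hx, norm_zero, mul_zero] at this
    exact norm_le_zero_iff.1 this
  let e := LinearEquiv.ofBijective (T : X →ₗ[𝕜] Y) ⟨hinj, hT⟩
  have he (y : Y) : T (e.symm y) = y := e.apply_symm_apply y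
  let R : Y →L[𝕜] X := LinearMap.mkContinuous e.symm C fun y => by
    have := hC (e.symm y)
    rwa [he] at this
  have hR : ‖R‖ ≤ C := LinearMap.mkContinuous_norm_le _ hC0 _
  have h1 : ‖-((S - T).comp R)‖ < 1 := by
    rw [norm_neg]
    refine lt_of_le_of_lt (ContinuousLinearMap.opNorm_comp_le _ _) (lt_of_le_of_lt ?_ h)
    exact mul_le_mul_of_nonneg_left hR (norm_nonneg _)
  obtain ⟨u, hu⟩ := isUnit_one_sub_of_norm_lt_one h1
  intro y
  set z : Y := (↑u⁻¹ : Y →L[𝕜] Y) y with hz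
  refine ⟨R z, ?_⟩
  have h2 : (u : Y →L[𝕜] Y) z = y := by
    rw [hz, ← mul_apply_eq_comp, u.mul_inv]
    rfl
  have h3 : T (R z) = z := he z
  rw [hu] at h2
  simp only [sub_neg_eq_add, add_apply, one_apply_eq_self, ContinuousLinearMap.comp_apply,
    sub_apply, h3] at h2
  rwa [add_sub_cancel] at h2

/-- The method of continuity. -/
lemma surjective_of_forall_norm_le {T : ℝ → X →L[𝕜] Y} {C M : ℝ} (hC0 : 0 ≤ C) (hM : 0 ≤ M)
    (hT : ∀ s t, ‖T s - T t‖ ≤ M * |s - t|)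
    (hC : ∀ t ∈ Set.Icc (0 : ℝ) 1, ∀ x, ‖x‖ ≤ C * ‖T t x‖) (h0 : Function.Surjective (T 0))
    {t : ℝ} (ht : t ∈ Set.Icc (0 : ℝ) 1) : Function.Surjective (T t) := by
  -- The interval from $0$ to $t$ is cut into $N$ equal steps, short enough for each to be a
  -- perturbation of the previous one.
  obtain ⟨N, hN⟩ := exists_nat_gt (M * C)
  have hN0 : (0 : ℝ) < N := (mul_nonneg hM hC0).trans_lt hN
  have key (k : ℕ) (hk : k ≤ N) : Function.Surjective (T (t * (k / N))) := by
    induction k with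
    | zero => simpa using h0
    | succ k ih =>
      have hk1 : (k : ℝ) + 1 ≤ N := by exact_mod_cast hk
      have hk2 : (k : ℝ) / N ≤ 1 := (div_le_one hN0).2 (by linarith)
      refine surjective_of_norm_sub_lt (hC _ ⟨mul_nonneg ht.1 (by positivity), ?_⟩)
        (ih (by omega)) hC0 ?_
      · exact mul_le_one₀ ht.2 (by positivity) hk2
      · have e : t * ((k + 1 : ℕ) / N) - t * (k / N) = t / N := by
          push_cast
          field_simp
          ring
        have h1 := hT (t * ((k + 1 : ℕ) / N)) (t * (k / N))
        rw [e, abs_of_nonneg (div_nonneg ht.1 hN0.le)] at h1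
        have h2 : M * (t / N) * C < 1 := by
          rw [show M * (t / N) * C = (M * C) * t / N by ring, div_lt_one hN0]
          exact (mul_le_of_le_one_right (mul_nonneg hM hC0) ht.2).trans_lt hN
        exact (mul_le_mul_of_nonneg_right h1 hC0).trans_lt h2
  have := key N le_rfl
  rwa [div_self hN0.ne', mul_one] at this

end Continuity

/-! ### The homotopy on the nonzero modes -/

variable (𝕜) in
/-- The operator `s ∂ₓ + ∂ₓ⁻¹∂_y + P - 2 t Q_c (1 - P)`, where `P` is the mean in `y`. -/
def opHom (c s t : ℝ) : E 𝕜 →L[𝕜] L2 𝕜 :=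
  (s : 𝕜) • dx 𝕜 + dxInvDy 𝕜 + (mean 𝕜).comp (incl 𝕜) -
    ((2 * t : ℝ) : 𝕜) • (mulKink 𝕜 c).comp (incl 𝕜 - (mean 𝕜).comp (incl 𝕜))

lemma opHom_apply (c s t : ℝ) (w : E 𝕜) :
    opHom 𝕜 c s t w = (s : 𝕜) • dx 𝕜 w + dxInvDy 𝕜 w + mean 𝕜 (incl 𝕜 w) -
      ((2 * t : ℝ) : 𝕜) • mulKink 𝕜 c (incl 𝕜 w - mean 𝕜 (incl 𝕜 w)) := rfl

lemma norm_incl_le (w : E 𝕜) : ‖incl 𝕜 w‖ ≤ ‖w‖ := by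
  rw [← sq_le_sq₀ (norm_nonneg _) (norm_nonneg _), norm_sq_E]
  nlinarith [sq_nonneg ‖dx 𝕜 w‖, sq_nonneg ‖dxInvDy 𝕜 w‖]

lemma norm_dxInvDy_le (w : E 𝕜) : ‖dxInvDy 𝕜 w‖ ≤ ‖w‖ := by
  rw [← sq_le_sq₀ (norm_nonneg _) (norm_nonneg _), norm_sq_E]
  nlinarith [sq_nonneg ‖dx 𝕜 w‖, sq_nonneg ‖incl 𝕜 w‖]

lemma norm_opHom_sub (c s t t' : ℝ) :
    ‖opHom 𝕜 c s t - opHom 𝕜 c s t'‖ ≤ 2 * Real.sqrt (c / 2) * |t - t'| := by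
  refine ContinuousLinearMap.opNorm_le_bound _ (by positivity) fun w => ?_
  have e : (opHom 𝕜 c s t - opHom 𝕜 c s t') w =
      ((2 * t' - 2 * t : ℝ) : 𝕜) • mulKink 𝕜 c (incl 𝕜 w - mean 𝕜 (incl 𝕜 w)) := by
    rw [sub_apply, opHom_apply, opHom_apply, RCLike.ofReal_sub, sub_smul]
    abel
  rw [e, norm_smul, RCLike.norm_ofReal, ← mul_sub, abs_mul, abs_sub_comm, abs_two]
  have h1 := (norm_mulKink_le c (incl 𝕜 w - mean 𝕜 (incl 𝕜 w))).trans
    (mul_le_mul_of_nonneg_left ((norm_sub_mean_le _).trans (norm_incl_le w)) (Real.sqrt_nonneg _))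
  calc 2 * |t - t'| * ‖mulKink 𝕜 c (incl 𝕜 w - mean 𝕜 (incl 𝕜 w))‖
      ≤ 2 * |t - t'| * (Real.sqrt (c / 2) * ‖w‖) := mul_le_mul_of_nonneg_left h1 (by positivity)
    _ = _ := by ring

/-- The kink term is of order zero, so the full energy norm is controlled once the $L^2$ norm of the
nonzero modes is. -/
lemma norm_E_le_opHom (c : ℝ) {s : ℝ} (hs : s ^ 2 = 1) {t : ℝ} (ht : t ∈ Set.Icc (0 : ℝ) 1)
    (w : E 𝕜) : ‖w‖ ≤ 2 * (‖opHom 𝕜 c s t w‖ +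
      2 * Real.sqrt (c / 2) * ‖incl 𝕜 w - mean 𝕜 (incl 𝕜 w)‖) := by
  refine (norm_E_le hs w).trans (mul_le_mul_of_nonneg_left ?_ zero_le_two)
  set x := incl 𝕜 w - mean 𝕜 (incl 𝕜 w) with hx
  have e : (s : 𝕜) • dx 𝕜 w + dxInvDy 𝕜 w + mean 𝕜 (incl 𝕜 w) =
      opHom 𝕜 c s t w + ((2 * t : ℝ) : 𝕜) • mulKink 𝕜 c x := by
    rw [opHom_apply]
    abel
  rw [e]
  refine (norm_add_le _ _).trans (add_le_add le_rfl ?_)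
  rw [norm_smul, RCLike.norm_ofReal, abs_of_nonneg (mul_nonneg zero_le_two ht.1), mul_assoc 2 t,
    mul_assoc]
  refine mul_le_mul_of_nonneg_left ?_ zero_le_two
  exact (mul_le_of_le_one_left (norm_nonneg _) ht.2).trans (norm_mulKink_le c x)

/-- The energy estimate for the adjoint operators. -/
lemma norm_sub_mean_sq_le {c : ℝ} (hc : 0 ≤ c) {t : ℝ} (ht : 0 ≤ t) (v : E 𝕜) :
    ‖incl 𝕜 v - mean 𝕜 (incl 𝕜 v)‖ ^ 2 ≤ ‖v‖ * ‖opHom 𝕜 c (-1) t v‖ := by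
  obtain ⟨g, h1, h2, h3, h4⟩ := exists_antideriv v
  set x := incl 𝕜 v - mean 𝕜 (incl 𝕜 v) with hx
  have a1 : RCLike.re (inner 𝕜 g (dx 𝕜 v)) = -‖x‖ ^ 2 := by
    have e1 := inner_isDx h1 (isDx_dx v)
    have e2 : inner 𝕜 x (mean 𝕜 (incl 𝕜 v)) = 0 := by
      rw [← inner_conj_symm, hx, inner_mean_sub_mean, map_zero]
    have e3 : inner 𝕜 x (incl 𝕜 v) = inner 𝕜 x x := by
      rw [← sub_eq_zero, ← inner_sub_right, hx, sub_sub_cancel, ← hx, e2]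
    have e4 : inner 𝕜 g (dx 𝕜 v) = -inner 𝕜 x x := by rw [← e3, e1, neg_neg]
    rw [e4, map_neg, inner_self_eq_norm_sq]
  have a2 : inner 𝕜 g (mean 𝕜 (incl 𝕜 v)) = 0 := by
    rw [← inner_mean, h2, inner_zero_left]
  -- Here $x=g'$, so $2\,\mathrm{Re}(Qg,g')=\|Qg\|^2-\frac c2\|g\|^2$, and $Q^2\le c/2$ fixes the
  -- sign.
  have a3 : RCLike.re (inner 𝕜 g (mulKink 𝕜 c x)) ≤ 0 := by
    rw [← inner_mulKink]
    have e1 := re_inner_mulKink_isDx hc h1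
    have e2 := norm_sq_mulKink_le hc g
    linarith
  have a4 : RCLike.re (inner 𝕜 g (opHom 𝕜 c (-1) t v)) =
      ‖x‖ ^ 2 - 2 * t * RCLike.re (inner 𝕜 g (mulKink 𝕜 c x)) := by
    rw [opHom_apply, inner_sub_right, inner_add_right, inner_add_right, a2, inner_smul_right,
      inner_smul_right, map_sub, map_add, map_add, h4, RCLike.re_ofReal_mul, RCLike.re_ofReal_mul,
      a1, map_zero]
    ring
  have a5 : RCLike.re (inner 𝕜 g (opHom 𝕜 c (-1) t v)) ≤ ‖g‖ * ‖opHom 𝕜 c (-1) t v‖ :=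
    re_inner_le_norm _ _
  have a6 := mul_le_mul_of_nonneg_right (h3.trans (norm_dxInvDy_le v))
    (norm_nonneg (opHom 𝕜 c (-1) t v))
  nlinarith

/-- The energy estimate is quadratic in the nonzero modes, and the full norm on its right side is
absorbed through `norm_E_le_opHom`. Uniformity in $t$ is what the method of continuity needs. -/
lemma norm_le_opHom_neg_one {c : ℝ} (hc : 0 ≤ c) {t : ℝ} (ht : t ∈ Set.Icc (0 : ℝ) 1)
    (v : E 𝕜) : ‖v‖ ≤ 2 * (1 + 2 * Real.sqrt (c / 2) * (2 + 4 * Real.sqrt (c / 2))) *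
      ‖opHom 𝕜 c (-1) t v‖ := by
  have h1 := norm_E_le_opHom c (s := -1) (by norm_num) ht v
  have h2 := norm_sub_mean_sq_le hc ht.1 v
  set a := Real.sqrt (c / 2)
  set y := ‖incl 𝕜 v - mean 𝕜 (incl 𝕜 v)‖
  set H := ‖opHom 𝕜 c (-1) t v‖
  have ha : 0 ≤ a := Real.sqrt_nonneg _
  have hy : 0 ≤ y := norm_nonneg _
  have hH : 0 ≤ H := norm_nonneg _
  -- From $y^2\le2(H+2ay)H$: if the bound failed, then $H\le y$, so $y^2\le(2+4a)\,yH<y^2$.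
  have h3 : y ≤ (2 + 4 * a) * H := by
    by_contra! hlt
    have hHy : H ≤ y := by nlinarith [mul_nonneg ha hH]
    have h4 : y ^ 2 ≤ 2 * (H + 2 * a * y) * H := h2.trans (mul_le_mul_of_nonneg_right h1 hH)
    have h5 : y * y ≤ y * ((2 + 4 * a) * H) := by nlinarith [mul_nonneg hH (sub_nonneg.2 hHy)]
    have hy0 : 0 < y := lt_of_le_of_lt (by positivity) hlt
    nlinarith
  have h6 := mul_le_mul_of_nonneg_left h3 (show 0 ≤ 2 * a by positivity)
  linarith

lemma surjective_opHom_neg_one {c : ℝ} (hc : 0 ≤ c) {t : ℝ} (ht : t ∈ Set.Icc (0 : ℝ) 1) :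
    Function.Surjective (opHom 𝕜 c (-1) t) := by
  refine surjective_of_forall_norm_le (by positivity) (by positivity)
    (norm_opHom_sub (𝕜 := 𝕜) c (-1)) (fun t ht v => norm_le_opHom_neg_one hc ht v) ?_ ht
  intro f
  obtain ⟨w, hw⟩ := exists_isDx_add_isDxInvDy (s := -1) (by norm_num) f
  refine ⟨w, ?_⟩
  rw [opHom_apply, hw]
  simp

/-- `opHom c (-1) t` is the formal adjoint of `opHom c 1 t`. -/
lemma inner_opHom (c t : ℝ) (w v : E 𝕜) :
    inner 𝕜 (opHom 𝕜 c 1 t w) (incl 𝕜 v) = inner 𝕜 (incl 𝕜 w) (opHom 𝕜 c (-1) t v) := by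
  have h1 := inner_isDx (isDx_dx w) (isDx_dx v)
  have h2 := inner_isDxInvDy (isDxInvDy_dxInvDy w) (isDxInvDy_dxInvDy v)
  have h3 := inner_mean (incl 𝕜 w) (incl 𝕜 v)
  have h4 : inner 𝕜 (mulKink 𝕜 c (incl 𝕜 w - mean 𝕜 (incl 𝕜 w))) (incl 𝕜 v) =
      inner 𝕜 (incl 𝕜 w) (mulKink 𝕜 c (incl 𝕜 v - mean 𝕜 (incl 𝕜 v))) := by
    rw [inner_mulKink, inner_sub_left, inner_mean, mean_mulKink, ← inner_sub_right, ← map_sub]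
  rw [opHom_apply, opHom_apply, inner_sub_left, inner_add_left, inner_add_left, inner_sub_right,
    inner_add_right, inner_add_right, inner_smul_left, inner_smul_left, inner_smul_right,
    inner_smul_right, h1, h2, h3, h4]
  simp

/-- The pairing used for $s=-1$ yields terms of opposite sign when $s=1$, so the bound comes by
duality: solving the adjoint equation with right side $w$ gives $\|w\|^2=(Hw,v)$ with $\|v\|\le
K\|w\|$, where $H$ is the operator with $s=1$. -/
lemma norm_le_opHom_one {c : ℝ} (hc : 0 ≤ c) : ∃ C, 0 ≤ C ∧ ∀ t ∈ Set.Icc (0 : ℝ) 1,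
    ∀ w : E 𝕜, ‖w‖ ≤ C * ‖opHom 𝕜 c 1 t w‖ := by
  set K := 2 * (1 + 2 * Real.sqrt (c / 2) * (2 + 4 * Real.sqrt (c / 2))) with hK
  refine ⟨2 * (1 + 2 * Real.sqrt (c / 2) * K), by positivity, fun t ht w => ?_⟩
  have h1 : ‖incl 𝕜 w‖ ≤ K * ‖opHom 𝕜 c 1 t w‖ := by
    obtain ⟨v, hv⟩ := surjective_opHom_neg_one hc ht (incl 𝕜 w)
    have h2 := (norm_incl_le v).trans (norm_le_opHom_neg_one hc ht v)
    rw [hv, ← hK] at h2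
    have h3 := congrArg RCLike.re (inner_opHom c t w v)
    rw [hv, inner_self_eq_norm_sq] at h3
    have h4 : ‖incl 𝕜 w‖ ^ 2 ≤ ‖opHom 𝕜 c 1 t w‖ * ‖incl 𝕜 v‖ := h3 ▸ re_inner_le_norm _ _
    have h5 := mul_le_mul_of_nonneg_left h2 (norm_nonneg (opHom 𝕜 c 1 t w))
    rcases (norm_nonneg (incl 𝕜 w)).eq_or_lt with h0 | h0
    · rw [← h0]
      positivity
    · nlinarith
  have h2 := norm_E_le_opHom c (s := 1) (by norm_num) ht w
  have h3 := (norm_sub_mean_le (incl 𝕜 w)).trans h1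
  have h6 := mul_le_mul_of_nonneg_left h3 (show 0 ≤ 2 * Real.sqrt (c / 2) by positivity)
  linarith

lemma surjective_opHom_one {c : ℝ} (hc : 0 ≤ c) {t : ℝ} (ht : t ∈ Set.Icc (0 : ℝ) 1) :
    Function.Surjective (opHom 𝕜 c 1 t) := by
  obtain ⟨C, hC0, hC⟩ := norm_le_opHom_one (𝕜 := 𝕜) hc
  refine surjective_of_forall_norm_le hC0 (by positivity)
    (norm_opHom_sub (𝕜 := 𝕜) c 1) hC ?_ ht
  intro f
  obtain ⟨w, hw⟩ := exists_isDx_add_isDxInvDy (s := 1) (by norm_num) f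
  refine ⟨w, ?_⟩
  rw [opHom_apply, hw]
  simp

/-! ### Functions with vanishing weak derivative -/

lemma exists_hasDerivAt_hasCompactSupport {h : ℝ → ℝ} (hd : ContDiff ℝ (↑(⊤ : ℕ∞)) h)
    (hc : HasCompactSupport h) (h0 : ∫ x, h x = 0) :
    ∃ ψ : ℝ → ℝ, ContDiff ℝ (↑(⊤ : ℕ∞)) ψ ∧ HasCompactSupport ψ ∧
      ∀ x, HasDerivAt ψ (h x) x := by
  obtain ⟨R, hR⟩ := hc.isCompact.isBounded.subset_closedBall 0
  rw [Real.closedBall_eq_Icc, zero_sub, zero_add] at hR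
  have hz (x : ℝ) (hx : x ∉ Set.Icc (-R) R) : h x = 0 :=
    image_eq_zero_of_notMem_tsupport fun h => hx (hR h)
  have hder (x : ℝ) : HasDerivAt (fun x => ∫ t in (-R - 1)..x, h t) (h x) x :=
    intervalIntegral.integral_hasDerivAt_right (hd.continuous.intervalIntegrable _ _)
      hd.continuous.aestronglyMeasurable.stronglyMeasurableAtFilter hd.continuous.continuousAt
  -- The primitive vanishes to the left of the support, and to the right of it because the total
  -- integral is zero. Starting at $-R-1$ keeps the endpoint $-R$ inside the half-open interval of
  -- integration.
  refine ⟨fun x => ∫ t in (-R - 1)..x, h t, ?_, ?_, hder⟩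
  · rw [contDiff_infty_iff_deriv]
    refine ⟨fun x => (hder x).differentiableAt, ?_⟩
    rwa [funext fun x => (hder x).deriv]
  · refine HasCompactSupport.intro (isCompact_Icc (a := -R - 1) (b := R)) fun x hx => ?_
    rcases lt_or_ge x (-R - 1) with h1 | h1
    · rw [intervalIntegral.integral_symm, neg_eq_zero]
      refine (intervalIntegral.integral_congr (g := fun _ => 0) fun t ht => ?_).trans (by simp)
      rw [Set.uIcc_of_le h1.le] at ht
      exact hz t fun h2 => by linarith [ht.2, h2.1]
    · have h2 : R < x := by
        by_contra! h3
        exact hx ⟨h1, h3⟩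
      rw [intervalIntegral.integral_eq_integral_of_support_subset, h0]
      intro t ht
      have h3 : t ∈ Set.Icc (-R) R := by
        by_contra h4
        exact ht (hz t h4)
      exact ⟨by linarith [h3.1], by linarith [h3.2]⟩

/-- A locally integrable function on `ℝ` with vanishing weak derivative is constant. -/
lemma exists_ae_eq_const {g : ℝ → ℂ} (hg : LocallyIntegrable g)
    (h : ∀ ψ : ℝ → ℝ, ContDiff ℝ (↑(⊤ : ℕ∞)) ψ → HasCompactSupport ψ →
      ∫ x, deriv ψ x • g x = 0) : ∃ K : ℂ, ∀ᵐ x, g x = K := by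
  let b : ContDiffBump (0 : ℝ) := ⟨1, 2, one_pos, one_lt_two⟩
  set χ : ℝ → ℝ := b.normed volume
  have hχd : ContDiff ℝ (↑(⊤ : ℕ∞)) χ := b.contDiff_normed
  have hχc : HasCompactSupport χ := b.hasCompactSupport_normed
  have hχi : ∫ x, χ x = 1 := b.integral_normed
  refine ⟨∫ x, χ x • g x, ?_⟩
  refine ae_eq_of_integral_contDiff_smul_eq hg (locallyIntegrable_const _) fun θ hθ hθc => ?_
  have hθi : Integrable θ := hθ.continuous.integrable_of_hasCompactSupport hθc
  have hχI : Integrable χ := hχd.continuous.integrable_of_hasCompactSupport hχc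
  -- Subtracting $(\int\theta)\chi$ from $\theta$ gives mean zero, so the difference is the
  -- derivative of a test function; the constant is then $\int\chi g$.
  obtain ⟨ψ, hψ1, hψ2, hψ3⟩ := exists_hasDerivAt_hasCompactSupport
    (h := fun x => θ x - (∫ t, θ t) * χ x) (hθ.sub (contDiff_const.mul hχd))
    (hθc.sub hχc.mul_left) (by
      rw [integral_sub hθi (hχI.const_mul _), integral_const_mul, hχi, mul_one, sub_self])
  have h1 := h ψ hψ1 hψ2
  have i1 : Integrable (fun x => θ x • g x) :=
    hg.integrable_smul_left_of_hasCompactSupport hθ.continuous hθc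
  have i2 : Integrable (fun x => χ x • g x) :=
    hg.integrable_smul_left_of_hasCompactSupport hχd.continuous hχc
  have i3 : Integrable (fun x => (∫ t, θ t) • (χ x • g x)) := i2.smul (∫ t, θ t)
  have h2 : (fun x => deriv ψ x • g x) = fun x => θ x • g x - (∫ t, θ t) • (χ x • g x) := by
    ext x
    rw [(hψ3 x).deriv, sub_smul, mul_smul]
  rw [h2, integral_sub i1 i3, integral_smul, sub_eq_zero] at h1
  rw [h1, integral_smul_const]

/-! ### Functions of `x` alone -/

lemma coefficient_one_of_ne {n : ℤ} (hn : n ≠ 0) : coefficient (fun _ => (1 : 𝕜)) n = 0 := by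
  have h := integral_fourier_mul_fourier 0 n
  rw [if_neg hn] at h
  simp only [fourier_zero, mul_one] at h
  rw [coefficient]
  have e : RCLike.map 𝕜 ℂ (1 : 𝕜) = 1 := by simp
  simp only [e, smul_eq_mul, mul_one, h, smul_zero]

lemma yMode_of_fst {f : ℝ → ℝ} {u : L2 𝕜} (hu : ∀ᵐ p : ℝ × Torus, u p = (f p.1 : 𝕜)) (n : ℤ) :
    ∀ᵐ x, yMode u n x = f x * coefficient (fun _ => (1 : 𝕜)) n := by
  have h : ∀ᵐ x : ℝ, ∀ᵐ y : Torus, u (x, y) = (f x : 𝕜) * 1 := by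
    simpa using Measure.ae_ae_of_ae_prod hu
  filter_upwards [h] with x hx
  rw [yMode, coefficient_congr hx, coefficient_smul, rclike_map_ofReal]

lemma isDx_of_hasDerivAt {f f' : ℝ → ℝ} (hf : ∀ x, HasDerivAt f (f' x) x) {u v : L2 𝕜}
    (hu : ∀ᵐ p : ℝ × Torus, u p = (f p.1 : 𝕜)) (hv : ∀ᵐ p : ℝ × Torus, v p = (f' p.1 : 𝕜)) :
    IsDx u v := by
  rw [isDx_iff]
  intro n
  refine isWeakDeriv_of_hasDerivAt (f := fun x => f x * coefficient (fun _ => (1 : 𝕜)) n)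
    (f' := fun x => f' x * coefficient (fun _ => (1 : 𝕜)) n)
    (fun x => (hf x).ofReal_comp.mul_const _) ?_ ?_
  · filter_upwards [(memLp_yMode u n).coeFn_toLp, yMode_of_fst hu n] with x h1 h2
    rw [h1, h2]
  · filter_upwards [(memLp_yMode v n).coeFn_toLp, yMode_of_fst hv n] with x h1 h2
    rw [h1, h2]

lemma mean_of_fst {f : ℝ → ℝ} {u : L2 𝕜} (hu : ∀ᵐ p : ℝ × Torus, u p = (f p.1 : 𝕜)) :
    mean 𝕜 u = u := by
  refine hat_injective fun n => ?_
  rcases eq_or_ne n 0 with rfl | hn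
  · exact hat_mean_zero u
  · rw [hat_mean_of_ne u hn, ← hat_zero (𝕜 := 𝕜) n]
    refine hat_eq_of_yMode_eq ?_
    filter_upwards [yMode_of_fst hu n, yMode_zero_ae (𝕜 := 𝕜) n] with x h1 h2
    rw [h1, h2, coefficient_one_of_ne hn, mul_zero]

lemma isDxInvDy_zero {u : L2 𝕜} (hu : mean 𝕜 u = u) : IsDxInvDy u 0 := by
  intro n
  filter_upwards [hat_zero_ae (𝕜 := 𝕜) n, hat_mean u n] with η h1 h2
  rw [hu] at h2
  rw [h1, h2]
  split_ifs with hn <;> simp [hn]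

/-- Fubini: a function of $x$ alone sees only the $y$-integral of `u`, which is $\sqrt{2\pi}$ times
its zero mode. -/
lemma integral_mul_yMode_eq_zero {f : ℝ → ℝ} {u v : L2 𝕜}
    (hv : ∀ᵐ p : ℝ × Torus, v p = (f p.1 : 𝕜)) (h : inner 𝕜 v u = 0) :
    ∫ x, f x * yMode u 0 x = 0 := by
  have hi := MeasureTheory.L2.integrable_inner (𝕜 := 𝕜) v u
  have hi' := (RCLike.map 𝕜 ℂ).integrable_comp hi
  have h1 := (RCLike.map 𝕜 ℂ).integral_comp_comm hi
  rw [← MeasureTheory.L2.inner_def, h, map_zero] at h1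
  have e : ∀ᵐ p : ℝ × Torus, RCLike.map 𝕜 ℂ (inner 𝕜 (v p) (u p)) =
      f p.1 * RCLike.map 𝕜 ℂ (u p) := by
    filter_upwards [hv] with p hp
    rw [hp, RCLike.inner_apply, RCLike.conj_ofReal, rclike_map_mul, rclike_map_ofReal, mul_comm]
  rw [integral_congr_ae e] at h1
  change ∫ p, _ ∂((volume : Measure ℝ).prod (volume : Measure Torus)) = 0 at h1
  rw [integral_prod _ ((integrable_congr e).1 hi')] at h1
  simp only [integral_const_mul] at h1
  have e2 (x : ℝ) : (f x : ℂ) * yMode u 0 x =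
      ((Real.sqrt (2 * π))⁻¹ : ℝ) * (f x * ∫ y : Torus, RCLike.map 𝕜 ℂ (u (x, y))) := by
    rw [yMode, coefficient, Complex.real_smul]
    simp only [neg_zero, fourier_zero, one_smul]
    ring
  simp_rw [e2]
  rw [integral_const_mul, h1, mul_zero]

/-! ### The soliton -/

lemma solitonL2_ae {c : ℝ} (hc : 0 < c) :
    ∀ᵐ p : ℝ × Torus, solitonL2 𝕜 hc p = (soliton c p.1 : 𝕜) := (memLp_soliton 𝕜 hc).coeFn_toLp

lemma hasDerivAt_cosh_sq (c x : ℝ) :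
    HasDerivAt (fun x => Real.cosh (Real.sqrt (c / 2) * x) ^ 2)
      (2 * kink c x * Real.cosh (Real.sqrt (c / 2) * x) ^ 2) x := by
  have h := (((hasDerivAt_id x).const_mul (Real.sqrt (c / 2))).cosh).pow 2
  refine h.congr_deriv ?_
  have := (Real.cosh_pos (Real.sqrt (c / 2) * x)).ne'
  simp only [kink, Real.tanh_eq_sinh_div_cosh, id]
  field_simp
  simp
  ring

lemma hasDerivAt_soliton (c x : ℝ) :
    HasDerivAt (soliton c) (-2 * kink c x * soliton c x) x := by
  have h0 : Real.cosh (Real.sqrt (c / 2) * x) ^ 2 ≠ 0 := (pow_pos (Real.cosh_pos _) 2).ne'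
  have h := ((hasDerivAt_cosh_sq c x).inv h0).const_mul c
  refine h.congr_deriv ?_
  rw [soliton]
  field_simp

lemma isDx_solitonL2 {c : ℝ} (hc : 0 < c) :
    IsDx (solitonL2 𝕜 hc) (((-2 : ℝ) : 𝕜) • mulKink 𝕜 c (solitonL2 𝕜 hc)) := by
  refine isDx_of_hasDerivAt (fun x => hasDerivAt_soliton c x) (solitonL2_ae hc) ?_
  filter_upwards [solitonL2_ae (𝕜 := 𝕜) hc, mulKink_ae c (solitonL2 𝕜 hc),
    Lp.coeFn_smul ((-2 : ℝ) : 𝕜) (mulKink 𝕜 c (solitonL2 𝕜 hc))] with p h1 h2 h3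
  rw [h3, Pi.smul_apply, h2, h1, smul_eq_mul]
  push_cast
  ring

variable (𝕜) in
/-- The line soliton as an element of `𝓔`. -/
def solitonE {c : ℝ} (hc : 0 < c) : E 𝕜 :=
  mkE (isDx_solitonL2 hc) (isDxInvDy_zero (mean_of_fst (solitonL2_ae (𝕜 := 𝕜) hc)))

lemma opL_apply (c : ℝ) (w : E 𝕜) : opL 𝕜 c w =
    dx 𝕜 w + dxInvDy 𝕜 w - (2 : 𝕜) • mulKink 𝕜 c (incl 𝕜 w) := rfl

lemma opLAdj_apply (c : ℝ) (w : E 𝕜) : opLAdj 𝕜 c w =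
    -dx 𝕜 w + dxInvDy 𝕜 w - (2 : 𝕜) • mulKink 𝕜 c (incl 𝕜 w) := rfl

lemma opLAdj_solitonE {c : ℝ} (hc : 0 < c) : opLAdj 𝕜 c (solitonE 𝕜 hc) = 0 := by
  rw [opLAdj_apply, solitonE, incl_mkE, dx_mkE, dxInvDy_mkE, add_zero, ← neg_smul, ← sub_smul]
  simp [map_ofNat]

/-- `𝓛_c` is the formal adjoint of `L_c`. -/
lemma inner_opL (c : ℝ) (w v : E 𝕜) :
    inner 𝕜 (opL 𝕜 c w) (incl 𝕜 v) = inner 𝕜 (incl 𝕜 w) (opLAdj 𝕜 c v) := by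
  have h1 := inner_isDx (isDx_dx w) (isDx_dx v)
  have h2 := inner_isDxInvDy (isDxInvDy_dxInvDy w) (isDxInvDy_dxInvDy v)
  rw [opL_apply, opLAdj_apply, inner_sub_left, inner_add_left, inner_sub_right, inner_add_right,
    inner_neg_right, inner_smul_left, inner_smul_right, h1, h2, inner_mulKink]
  simp [map_ofNat]

/-! ### Range and lower bound of `L_c` -/

lemma incl_meanE (w : E 𝕜) : incl 𝕜 (meanE w) = mean 𝕜 (incl 𝕜 w) := rfl

lemma dx_meanE (w : E 𝕜) : dx 𝕜 (meanE w) = mean 𝕜 (dx 𝕜 w) := rfl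

lemma dxInvDy_meanE (w : E 𝕜) : dxInvDy 𝕜 (meanE w) = 0 := mean_dxInvDy w

/-- At $t=1$, `opHom` and `opL` agree off the zero mode, so the bound for the homotopy transfers to
the nonzero modes of $L_c$. -/
lemma opHom_sub_meanE (c : ℝ) (w : E 𝕜) :
    opHom 𝕜 c 1 1 (w - meanE w) = opL 𝕜 c w - mean 𝕜 (opL 𝕜 c w) := by
  rw [opHom_apply, opL_apply]
  simp only [map_sub, map_add, map_smul, incl_meanE, dx_meanE, dxInvDy_meanE, mean_mean,
    mean_mulKink, mean_dxInvDy, sub_self, sub_zero, add_zero, RCLike.ofReal_one, one_smul,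
    mul_one, smul_sub, RCLike.ofReal_ofNat]
  abel

/-- The lower bound on the zero mode. -/
lemma norm_mean_incl_le {c : ℝ} (hc : 0 ≤ c) (w : E 𝕜) :
    c * ‖mean 𝕜 (incl 𝕜 w)‖ ^ 2 ≤ ‖opL 𝕜 c w‖ ^ 2 := by
  set z := mean 𝕜 (incl 𝕜 w) with hz
  have h1 : mean 𝕜 (opL 𝕜 c w) = mean 𝕜 (dx 𝕜 w) - (2 : 𝕜) • mulKink 𝕜 c z := by
    rw [opL_apply, map_sub, map_add, mean_dxInvDy, add_zero, map_smul, mean_mulKink]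
  have h2 := re_inner_mulKink_isDx hc (isDx_dx w).mean
  rw [← hz] at h2
  have h3 := pow_le_pow_left₀ (norm_nonneg _) (norm_mean_le (opL 𝕜 c w)) 2
  rw [h1, norm_sub_sq (𝕜 := 𝕜), inner_smul_right, norm_smul, RCLike.norm_ofNat,
    show (2 : 𝕜) = ((2 : ℝ) : 𝕜) from (RCLike.ofReal_ofNat 2).symm, RCLike.re_ofReal_mul,
    inner_re_symm] at h3
  -- After inserting `h2`, the expanded square reads $\|z'\|^2+2\|Qz\|^2+c\|z\|^2$.
  nlinarith [sq_nonneg ‖mulKink 𝕜 c z‖, sq_nonneg ‖mean 𝕜 (dx 𝕜 w)‖]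

/-- The zero mode costs $1/\sqrt c$ and the nonzero modes the constant of `norm_le_opHom_one`. With
$w$ bounded in $L^2$, the terms $2Q_cw$ and $Pw$ are moved to the right side, and `norm_E_le`
recovers the energy norm. -/
lemma exists_norm_le_opL {c : ℝ} (hc : 0 < c) :
    ∃ C, 0 < C ∧ ∀ w : E 𝕜, ‖w‖ ≤ C * ‖opL 𝕜 c w‖ := by
  obtain ⟨C, hC0, hC⟩ := norm_le_opHom_one (𝕜 := 𝕜) hc.le
  set a := Real.sqrt (c / 2) with ha
  have ha0 : 0 ≤ a := Real.sqrt_nonneg _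
  set b := (Real.sqrt c)⁻¹ with hb
  have hb0 : 0 ≤ b := by positivity
  refine ⟨2 * (1 + (2 * a + 1) * (b + C)), by positivity, fun w => ?_⟩
  have h1 : ‖mean 𝕜 (incl 𝕜 w)‖ ≤ b * ‖opL 𝕜 c w‖ := by
    have h := Real.sqrt_le_sqrt (norm_mean_incl_le hc.le w)
    rw [Real.sqrt_mul hc.le, Real.sqrt_sq (norm_nonneg _), Real.sqrt_sq (norm_nonneg _)] at h
    rw [hb, inv_mul_eq_div, le_div_iff₀ (Real.sqrt_pos.2 hc)]
    linarith
  have h2 : ‖incl 𝕜 w - mean 𝕜 (incl 𝕜 w)‖ ≤ C * ‖opL 𝕜 c w‖ := by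
    have h := hC 1 ⟨zero_le_one, le_rfl⟩ (w - meanE w)
    rw [opHom_sub_meanE] at h
    have h' := norm_incl_le (w - meanE w)
    rw [map_sub, incl_meanE] at h'
    exact (h'.trans h).trans (mul_le_mul_of_nonneg_left (norm_sub_mean_le _) hC0)
  have h3 : ‖incl 𝕜 w‖ ≤ (b + C) * ‖opL 𝕜 c w‖ := by
    have := norm_add_le (mean 𝕜 (incl 𝕜 w)) (incl 𝕜 w - mean 𝕜 (incl 𝕜 w))
    rw [add_sub_cancel] at this
    linarith
  have h4 : ‖w‖ ≤ 2 * (‖opL 𝕜 c w‖ + (2 * a + 1) * ‖incl 𝕜 w‖) := by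
    refine (norm_E_le (s := 1) (by norm_num) w).trans
      (mul_le_mul_of_nonneg_left ?_ zero_le_two)
    have e : ((1 : ℝ) : 𝕜) • dx 𝕜 w + dxInvDy 𝕜 w + mean 𝕜 (incl 𝕜 w) =
        opL 𝕜 c w + ((2 : 𝕜) • mulKink 𝕜 c (incl 𝕜 w) + mean 𝕜 (incl 𝕜 w)) := by
      rw [opL_apply, RCLike.ofReal_one, one_smul]
      abel
    rw [e]
    refine (norm_add_le _ _).trans (add_le_add le_rfl ((norm_add_le _ _).trans ?_))
    rw [norm_smul, RCLike.norm_ofNat]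
    have h5 := norm_mulKink_le c (incl 𝕜 w)
    have h6 := norm_mean_le (incl 𝕜 w)
    rw [← ha] at h5
    linarith
  have h7 := mul_le_mul_of_nonneg_left h3 (show 0 ≤ 2 * a + 1 by positivity)
  linarith

/-- The nonzero modes belong to the range of `L_c`. -/
lemma mem_range_opL_of_mean {c : ℝ} (hc : 0 ≤ c) {f : L2 𝕜} (hf : mean 𝕜 f = 0) :
    ∃ w : E 𝕜, opL 𝕜 c w = f := by
  obtain ⟨w, hw⟩ := surjective_opHom_one hc (t := 1) ⟨zero_le_one, le_rfl⟩ f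
  -- The zero mode of the equation reads $(\partial_x+P)Pw=0$, and `norm_E_le` excludes nonzero
  -- solutions.
  have h0 : meanE w = 0 := by
    have h1 := norm_E_le (s := 1) (by norm_num) (meanE w)
    have h2 := congrArg (mean 𝕜) hw
    rw [opHom_apply, hf] at h2
    simp only [map_sub, map_add, map_smul, mean_mean, mean_mulKink, mean_dxInvDy, sub_self,
      smul_zero, sub_zero] at h2
    rw [dx_meanE, dxInvDy_meanE, incl_meanE, mean_mean, h2, norm_zero, mul_zero] at h1
    exact norm_le_zero_iff.1 h1
  refine ⟨w, ?_⟩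
  have h1 : mean 𝕜 (incl 𝕜 w) = 0 := by rw [← incl_meanE, h0, map_zero]
  rw [← hw, opHom_apply, opL_apply, h1]
  simp [map_ofNat]

/-- For $c=0$ the kink vanishes, and $\partial_x+\partial_x^{-1}\partial_y+P$ maps $\mathcal E$
bijectively onto $L^2$, boundedly in both directions. Completeness is what lets a lower bound imply
closed range. -/
instance completeSpaceE : CompleteSpace (E 𝕜) := by
  have hs := surjective_opHom_one (𝕜 := 𝕜) (c := 0) le_rfl (t := 1) ⟨zero_le_one, le_rfl⟩
  obtain ⟨C, hC0, hC⟩ := norm_le_opHom_one (𝕜 := 𝕜) (c := 0) le_rfl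
  have ha : AntilipschitzWith ⟨C, hC0⟩ (opHom 𝕜 0 1 1) :=
    AddMonoidHomClass.antilipschitz_of_bound _ (hC 1 ⟨zero_le_one, le_rfl⟩)
  exact ((ha.isUniformEmbedding (opHom 𝕜 0 1 1).uniformContinuous).completeSpace_congr hs).2
    inferInstance

/-! ### The orthogonal complement of the range -/

lemma memLp_comp_fst {f : ℝ → ℝ} (hf : MemLp f 2 volume) :
    MemLp (fun p : ℝ × Torus => (f p.1 : 𝕜)) 2 volume := by
  have h2 : MemLp (fun p : ℝ × Torus => f p.1) 2
    ((volume : Measure ℝ).prod (volume : Measure Torus)) := hf.comp_fst _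
  exact h2.ofReal

/-- The zero mode of an element orthogonal to the range of `L_c` is tested with
`L_c (cosh² ψ) = cosh² ψ'`. -/
lemma integral_test_eq_zero {c : ℝ} (hc : 0 ≤ c) {u : L2 𝕜}
    (hL : ∀ w : E 𝕜, inner 𝕜 (opL 𝕜 c w) u = 0) {ψ : ℝ → ℝ}
    (hψ : ContDiff ℝ (↑(⊤ : ℕ∞)) ψ) (hψc : HasCompactSupport ψ) :
    ∫ x, deriv ψ x • (((Real.cosh (Real.sqrt (c / 2) * x) ^ 2 : ℝ) : ℂ) * yMode u 0 x) = 0 := by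
  set k : ℝ → ℝ := fun x => Real.cosh (Real.sqrt (c / 2) * x) ^ 2 with hk
  set f : ℝ → ℝ := fun x => k x * ψ x with hf
  set f' : ℝ → ℝ := fun x => 2 * kink c x * k x * ψ x + k x * deriv ψ x with hf'
  have hψ' : Continuous (deriv ψ) := hψ.continuous_deriv (by simp)
  have hkc : Continuous k := by fun_prop
  have hq := continuous_kink hc
  have hfm : MemLp f 2 volume :=
    (hkc.mul hψ.continuous).memLp_of_hasCompactSupport hψc.mul_left
  have hfm' : MemLp f' 2 volume :=
    ((((continuous_const.mul hq).mul hkc).mul hψ.continuous).add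
      (hkc.mul hψ')).memLp_of_hasCompactSupport (hψc.mul_left.add hψc.deriv.mul_left)
  have hd (x : ℝ) : HasDerivAt f (f' x) x :=
    (hasDerivAt_cosh_sq c x).mul (hψ.differentiable (by simp) x).hasDerivAt
  have ew := (memLp_comp_fst (𝕜 := 𝕜) hfm).coeFn_toLp
  have ew' := (memLp_comp_fst (𝕜 := 𝕜) hfm').coeFn_toLp
  set w := (memLp_comp_fst (𝕜 := 𝕜) hfm).toLp
  set w' := (memLp_comp_fst (𝕜 := 𝕜) hfm').toLp
  have hD : IsDx w w' := isDx_of_hasDerivAt hd ew ew'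
  have hv : ∀ᵐ p : ℝ × Torus, opL 𝕜 c (mkE hD (isDxInvDy_zero (mean_of_fst ew))) p =
      ((k p.1 * deriv ψ p.1 : ℝ) : 𝕜) := by
    rw [opL_apply, incl_mkE, dx_mkE, dxInvDy_mkE, add_zero]
    filter_upwards [Lp.coeFn_sub w' ((2 : 𝕜) • mulKink 𝕜 c w),
      Lp.coeFn_smul (2 : 𝕜) (mulKink 𝕜 c w), mulKink_ae c w, ew, ew'] with p h1 h2 h3 h4 h5
    rw [h1, Pi.sub_apply, h2, Pi.smul_apply, h3, h4, h5, smul_eq_mul, hf, hf']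
    push_cast
    ring
  rw [← integral_mul_yMode_eq_zero (f := fun x => k x * deriv ψ x) hv (hL _)]
  congr 1
  ext x
  rw [Complex.real_smul, Complex.ofReal_mul, mul_left_comm, mul_assoc]

/-- A function in `L²` orthogonal to the range of `L_c` and to the soliton vanishes. -/
lemma eq_zero_of_orthogonal {c : ℝ} (hc : 0 < c) {u : L2 𝕜}
    (hL : ∀ w : E 𝕜, inner 𝕜 (opL 𝕜 c w) u = 0) (hφ : inner 𝕜 (solitonL2 𝕜 hc) u = 0) :
    u = 0 := by
  -- The part of `u` in the nonzero modes lies in the range, hence is orthogonal to itself.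
  have hmean : mean 𝕜 u = u := by
    obtain ⟨w, hw⟩ := mem_range_opL_of_mean hc.le (f := u - mean 𝕜 u)
      (by rw [map_sub, mean_mean, sub_self])
    have h1 := hL w
    have h2 : inner 𝕜 (u - mean 𝕜 u) (mean 𝕜 u) = 0 := by
      rw [← inner_conj_symm, inner_mean_sub_mean, map_zero]
    have h3 : inner 𝕜 (u - mean 𝕜 u) (u - mean 𝕜 u) = 0 := by
      rw [inner_sub_right, h2, ← hw, h1, sub_zero]
    exact (sub_eq_zero.1 (inner_self_eq_zero.1 h3)).symm
  set a := Real.sqrt (c / 2) with ha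
  have hcosh (x : ℝ) : Real.cosh (a * x) ^ 2 ≠ 0 := (pow_pos (Real.cosh_pos _) 2).ne'
  have hloc : LocallyIntegrable (fun x => ((Real.cosh (a * x) ^ 2 : ℝ) : ℂ) * yMode u 0 x) :=
    ((memLp_yMode u 0).locallyIntegrable one_le_two).continuous_mul (by fun_prop)
  obtain ⟨K, hK⟩ := exists_ae_eq_const hloc fun ψ hψ hψc => integral_test_eq_zero hc.le hL hψ hψc
  have h1 := integral_mul_yMode_eq_zero (solitonL2_ae hc) hφ
  have hs (x : ℝ) : soliton c x = c / Real.cosh (a * x) ^ 2 := by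
    rw [soliton, ha, ← div_eq_mul_inv]
  have hu : ∀ᵐ x, yMode u 0 x = ((Real.cosh (a * x) ^ 2)⁻¹ : ℝ) * K := by
    filter_upwards [hK] with x hx
    have := hcosh x
    rw [← hx, ← mul_assoc, ← Complex.ofReal_mul, inv_mul_cancel₀ this, Complex.ofReal_one, one_mul]
  have hK0 : K = 0 := by
    by_contra hK1
    -- Both $\varphi_c$ and $u_0$ are multiples of $\cosh^{-2}$, and $K\ne0$, so square
    -- integrability of $\varphi_c$ is inherited from $u_0$.
    have hsq : Integrable fun x => soliton c x ^ 2 := by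
      have i1 := ((memLp_two_iff_integrable_sq_norm (aestronglyMeasurable_yMode u 0)).1
        (memLp_yMode u 0)).const_mul (c ^ 2 / ‖K‖ ^ 2)
      refine (integrable_congr ?_).1 i1
      filter_upwards [hu] with x hx
      have h0 := hcosh x
      have h2 : ‖K‖ ≠ 0 := norm_ne_zero_iff.2 hK1
      rw [hx, norm_mul, Complex.norm_real, Real.norm_eq_abs, mul_pow, sq_abs, hs]
      field_simp
    have e : ∀ᵐ x, (soliton c x : ℂ) * yMode u 0 x = ((c⁻¹ * soliton c x ^ 2 : ℝ) : ℂ) * K := by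
      filter_upwards [hu] with x hx
      have h0 := hcosh x
      have e2 : soliton c x * (Real.cosh (a * x) ^ 2)⁻¹ = c⁻¹ * soliton c x ^ 2 := by
        rw [hs]
        field_simp
      rw [hx, ← mul_assoc, ← Complex.ofReal_mul, e2]
    rw [integral_congr_ae e, integral_mul_const, integral_complex_ofReal, mul_eq_zero,
      Complex.ofReal_eq_zero, integral_const_mul, mul_eq_zero] at h1
    have h2 := (h1.resolve_right hK1).resolve_left (inv_ne_zero hc.ne')
    rw [integral_eq_zero_iff_of_nonneg (fun x => sq_nonneg _) hsq] at h2
    have h3 : ∀ᵐ x : ℝ, False := by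
      filter_upwards [h2] with x hx
      have h4 : soliton c x ≠ 0 := by
        rw [hs]
        exact div_ne_zero hc.ne' (hcosh x)
      exact pow_ne_zero 2 h4 hx
    obtain ⟨_, h4⟩ := h3.exists
    exact h4
  refine hat_injective fun n => ?_
  rcases eq_or_ne n 0 with rfl | hn
  · refine hat_eq_of_yMode_eq ?_
    filter_upwards [hu, yMode_zero_ae (𝕜 := 𝕜) 0] with x h1 h2
    rw [h1, h2, hK0, mul_zero]
  · rw [← hmean, hat_mean_of_ne u hn, hat_zero]

/-! ### Range, kernels and the Fredholm property -/

lemma range_opL {c : ℝ} (hc : 0 < c) :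
    (opL 𝕜 c).range = (Submodule.span 𝕜 {solitonL2 𝕜 hc})ᗮ ∧
      Topology.IsClosedEmbedding (opL 𝕜 c) := by
  obtain ⟨C, hC0, hC⟩ := exists_norm_le_opL (𝕜 := 𝕜) hc
  have ha : AntilipschitzWith ⟨C, hC0.le⟩ (opL 𝕜 c) :=
    AddMonoidHomClass.antilipschitz_of_bound _ hC
  have hcl := ha.isClosedEmbedding (opL 𝕜 c).uniformContinuous
  refine ⟨?_, hcl⟩
  have hle : (opL 𝕜 c).range ≤ (Submodule.span 𝕜 {solitonL2 𝕜 hc})ᗮ := by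
    rintro _ ⟨w, rfl⟩
    rw [Submodule.mem_orthogonal_singleton_iff_inner_left]
    have := inner_opL c w (solitonE 𝕜 hc)
    rw [opLAdj_solitonE, inner_zero_right] at this
    exact this
  have : CompleteSpace (opL 𝕜 c).range := hcl.isClosed_range.completeSpace_coe
  -- A closed subspace $V\subseteq W$ satisfies $W=V\oplus(V^\perp\cap W)$, so equality follows once
  -- the second summand vanishes.
  have hbot : (opL 𝕜 c).rangeᗮ ⊓ (Submodule.span 𝕜 {solitonL2 𝕜 hc})ᗮ = ⊥ := by
    rw [eq_bot_iff]
    rintro u ⟨h1, h2⟩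
    refine (Submodule.mem_bot 𝕜).2 (eq_zero_of_orthogonal hc (fun w => h1 _ ⟨w, rfl⟩) ?_)
    exact Submodule.mem_orthogonal_singleton_iff_inner_right.1 h2
  have hsup := Submodule.sup_orthogonal_inf_of_hasOrthogonalProjection hle
  rwa [hbot, sup_bot_eq] at hsup

/-- The kernel of the formal adjoint is orthogonal to the range of $L_c$, hence lies in
$(\varphi_c^\perp)^\perp$, a line. -/
lemma map_ker_opLAdj {c : ℝ} (hc : 0 < c) :
    (opLAdj 𝕜 c).ker.map (incl 𝕜 : E 𝕜 →ₗ[𝕜] L2 𝕜) = Submodule.span 𝕜 {solitonL2 𝕜 hc} := by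
  apply le_antisymm
  · rintro _ ⟨v, hv, rfl⟩
    rw [← Submodule.orthogonal_orthogonal (Submodule.span 𝕜 {solitonL2 𝕜 hc}),
      ← (range_opL hc).1, Submodule.mem_orthogonal]
    rintro _ ⟨w, rfl⟩
    have := inner_opL c w v
    rw [show opLAdj 𝕜 c v = 0 from hv, inner_zero_right] at this
    exact this
  · rw [Submodule.span_le, Set.singleton_subset_iff]
    exact ⟨solitonE 𝕜 hc, opLAdj_solitonE hc, rfl⟩

lemma ker_opL {c : ℝ} (hc : 0 < c) : (opL 𝕜 c).ker = ⊥ :=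
  LinearMap.ker_eq_bot.2 (range_opL hc).2.injective

lemma isFredholm_opL {c : ℝ} (hc : 0 < c) : (opL 𝕜 c).IsFredholm where
  isStrictMap := (range_opL hc).2.isClosedMap.isStrictMap (opL 𝕜 c).continuous
  isClosed_range := (range_opL hc).2.isClosed_range
  finite_ker := by
    rw [ker_opL hc]
    infer_instance
  finite_coker := by
    rw [(range_opL hc).1]
    exact (Submodule.fg_span_singleton _).cofg_of_isCompl (Submodule.isCompl_orthogonal _)
  closedComplemented_ker := by
    rw [ker_opL hc]
    exact Submodule.closedComplemented_bot

end KPII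

theorem lemma3p2 (𝕜 : Type*) [RCLike 𝕜] (c : ℝ) (hc : 0 < c) :
    -- `ker L_c = {0}`
    (KPII.opL 𝕜 c).ker = ⊥ ∧
    -- `𝓛_c` is the formal adjoint of `L_c`, and `ker 𝓛_c = span {φ_c}` (as subspaces of `L²`)
    (∀ w v : KPII.E 𝕜,
      inner 𝕜 (KPII.opL 𝕜 c w) (KPII.incl 𝕜 v) = inner 𝕜 (KPII.incl 𝕜 w) (KPII.opLAdj 𝕜 c v)) ∧
    (KPII.opLAdj 𝕜 c).ker.map (KPII.incl 𝕜 : KPII.E 𝕜 →ₗ[𝕜] KPII.L2 𝕜) =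
      Submodule.span 𝕜 {KPII.solitonL2 𝕜 hc} ∧
    -- `L_c` is Fredholm with range `(φ_c)^⊥`
    (KPII.opL 𝕜 c).IsFredholm ∧
    (KPII.opL 𝕜 c).range = (Submodule.span 𝕜 {KPII.solitonL2 𝕜 hc})ᗮ ∧
    -- `L_c` is bounded from below
    ∃ C : ℝ, 0 < C ∧ ∀ w : KPII.E 𝕜, ‖w‖ ≤ C * ‖KPII.opL 𝕜 c w‖ := by
  exact ⟨KPII.ker_opL hc, KPII.inner_opL c, KPII.map_ker_opLAdj hc, KPII.isFredholm_opL hc,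
    (KPII.range_opL hc).1, KPII.exists_norm_le_opL hc⟩
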